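/- Let $(M,g)$ be a compact smooth $d$-dimensional Riemannian manifold, whose boundary is empty or smooth, with Levi-Civita connection $\nabla$ and Riemannian volume measure $d\mathrm{vol}_g$. Let $f=(f_1,\dots,f_D):M\to\mathbb{R}^D$ be a smooth embedding, i.e. a smooth map which is a homeomorphism onto its image and whose differential $df$ is injective at every point. Let $g_f(u,v)=\langle df(u),df(v)\rangle$ be the pullback metric and $\nabla^f$ its Levi-Civita connection. For vector fields $u,v$ let $\nabla^2 f(u,v)=\big(u(vf_j)-(\nabla_u v)f_j\big)_{1\le j\le D}$ be the vector-valued Hessian, and let $\mathrm{II}(u,v)$ be the second fundamental form of $f(M)\subset\mathbb{R}^D$, i.e. the component of the Euclidean covariant derivative $\overline\nabla_{df(u)}df(v)$ that is normal to $f(M)$. Then: (i) For all smooth vector fields $u,v$ on $M$, $$\nabla^2 f(u,v)=\mathrm{II}(u,v)+df\big(\nabla^f_u v-\nabla_u v\big).$$ (ii) At every point $m\in M$, $\mathrm{II}(u,v)$ is normal to $f(M)$ at $f(m)$, the two terms on the right-hand side of (i) are orthogonal in $\mathbb{R}^D$, and $$\|\nabla^2 f(u,v)\|^2=\|\mathrm{II}(u,v)\|^2+\|df(\nabla^f_u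 v-\nabla_u v)\|^2 .$$ Moreover each of $\nabla^2 f(u,v)$, $\mathrm{II}(u,v)$ and $df(\nabla^f_uv-\nabla_uv)$ depends, at $m$, only on the values of $u$ and $v$ at $m$. (iii) For an $\mathbb{R}^D$-valued $(0,2)$-tensor $J=(J_1,\dots,J_D)$ put $\|J\|_{L^2(M)}^2=\int_M\sum_{j=1}^D|J_j|_g^2\,d\mathrm{vol}_g$, where $|J_j(m)|_g^2=\sum_{i,k=1}^d J_j(e_i,e_k)^2$ for a $g$-orthonormal basis $(e_i)$ of $T_mM$. For every choice, at each $m\in M$, of a $g$-orthonormal basis $(e_i)_{i=1}^d$ of $T_mM$, all the integrands below are integrable and $$\|\nabla^2 f\|_{L^2(M)}^2=\|\mathrm{II}\|_{L^2(M)}^2+\int_M\sum_{i,k=1}^d\big\|df\big(\nabla^f_{e_i}e_k-\nabla_{e_i}e_k\big)\big\|^2\,d\mathrm{vol}_g .$$ If moreover the bases are chosen so that each function $m\mapsto\|df(\nabla^f_{e_i}e_k-\nabla_{e_i}e_k)\|^2$ is measurable, then the last term equals $\sum_{i,k=1}^d\int_M\|df(\nabla^f_{e_i}e_k-\nabla_{e_i}e_k)\|^2\,d\mathrm{vol}_g$.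 -/

import Mathlib

open Bundle Manifold VectorField FiberBundle MeasureTheory
open scoped ContDiff Topology

noncomputable section

namespace EmbeddingPenalty

/-! ### Riemannian metrics and the Levi-Civita connection -/

section Connection

variable {E : Type*} [NormedAddCommGroup E] [NormedSpace ℝ E]
  {H : Type*} [TopologicalSpace H] {I : ModelWithCorners ℝ E H}
  {M : Type*} [TopologicalSpace M] [ChartedSpace H M] [IsManifold I ∞ M]

variable (I M) in
/-- Smooth Riemannian metrics on the manifold `M`. -/
abbrev Metric : Type _ :=
  ContMDiffRiemannianMetric I ∞ E (fun x : M ↦ TangentSpace I x)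

variable (g : Metric I M)

lemma Metric.nondegenerate {x : M} {a b : TangentSpace I x}
    (h : ∀ z, g.inner x a z = g.inner x b z) : a = b := by
  by_contra hab
  have h1 := g.pos x (a - b) (sub_ne_zero.mpr hab)
  have h2 : g.inner x (a - b) (a - b) = 0 := by
    rw [map_sub (g.inner x)]
    exact sub_eq_zero.mpr (h (a - b))
  exact h1.ne' h2

lemma Metric.mdifferentiableAt {X Y : Π x : M, TangentSpace I x} {x : M}
    (hX : MDiffAt (T% X) x) (hY : MDiffAt (T% Y) x) :
    MDiffAt (fun p ↦ g.inner p (X p) (Y p)) x := by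
  have hg : MDifferentiableAt I (I.prod 𝓘(ℝ, E →L[ℝ] E →L[ℝ] ℝ))
      (fun b ↦ TotalSpace.mk' (E →L[ℝ] E →L[ℝ] ℝ) b (g.inner b)) x :=
    g.contMDiff.mdifferentiableAt (by simp)
  have := MDifferentiableAt.clm_bundle_apply₂ (F₁ := E) (F₂ := E) (F₃ := ℝ)
    (E₃ := Bundle.Trivial M ℝ) (b := id) hg hX hY
  simp only [mdifferentiableAt_totalSpace] at this
  exact this.2

/-- The right-hand side of the Koszul formula: `2 g(∇_X Y, Z)`. -/
def koszul (Y X Z : Π x : M, TangentSpace I x) (x : M) : ℝ :=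
  d% (fun p ↦ g.inner p (Y p) (Z p)) x (X x) + d% (fun p ↦ g.inner p (X p) (Z p)) x (Y x)
    - d% (fun p ↦ g.inner p (X p) (Y p)) x (Z x)
    + g.inner x (mlieBracket I X Y x) (Z x) - g.inner x (mlieBracket I X Z x) (Y x)
    - g.inner x (mlieBracket I Y Z x) (X x)

variable [FiniteDimensional ℝ E]

lemma koszul_tensorial_left {Y Z : Π x : M, TangentSpace I x} {x : M}
    (hY : MDiffAt (T% Y) x) (hZ : MDiffAt (T% Z) x) :
    TensorialAt I E (fun X ↦ koszul g Y X Z x) x where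
  smul {a X} ha hX := by
    have h1 : (fun p ↦ g.inner p ((a • X) p) (Z p)) = a * fun p ↦ g.inner p (X p) (Z p) := by
      ext p; simp
    have h2 : (fun p ↦ g.inner p ((a • X) p) (Y p)) = a * fun p ↦ g.inner p (X p) (Y p) := by
      ext p; simp
    simp only [koszul]
    rw [h1, h2, mvfderiv_mul ha (g.mdifferentiableAt hX hZ),
      mvfderiv_mul ha (g.mdifferentiableAt hX hY), mlieBracket_smul_left ha hX,
      mlieBracket_smul_left ha hX]
    simp
    ring
  add {X X'} hX hX' := by
    have h1 : (fun p ↦ g.inner p ((X + X') p) (Z p)) =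
        (fun p ↦ g.inner p (X p) (Z p)) + fun p ↦ g.inner p (X' p) (Z p) := by
      ext p; simp
    have h2 : (fun p ↦ g.inner p ((X + X') p) (Y p)) =
        (fun p ↦ g.inner p (X p) (Y p)) + fun p ↦ g.inner p (X' p) (Y p) := by
      ext p; simp
    simp only [koszul]
    rw [h1, h2, mvfderiv_add (g.mdifferentiableAt hX hZ) (g.mdifferentiableAt hX' hZ),
      mvfderiv_add (g.mdifferentiableAt hX hY) (g.mdifferentiableAt hX' hY),
      mlieBracket_add_left hX hX', mlieBracket_add_left hX hX']
    simp
    ring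

lemma koszul_tensorial_right {Y X : Π x : M, TangentSpace I x} {x : M}
    (hY : MDiffAt (T% Y) x) (hX : MDiffAt (T% X) x) :
    TensorialAt I E (fun Z ↦ koszul g Y X Z x) x where
  smul {a Z} ha hZ := by
    have h1 : (fun p ↦ g.inner p (Y p) ((a • Z) p)) = a * fun p ↦ g.inner p (Y p) (Z p) := by
      ext p; simp
    have h2 : (fun p ↦ g.inner p (X p) ((a • Z) p)) = a * fun p ↦ g.inner p (X p) (Z p) := by
      ext p; simp
    simp only [koszul]
    rw [h1, h2, mvfderiv_mul ha (g.mdifferentiableAt hY hZ),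
      mvfderiv_mul ha (g.mdifferentiableAt hX hZ), mlieBracket_smul_right ha hZ,
      mlieBracket_smul_right ha hZ]
    simp [g.symm x (Z x)]
    ring
  add {Z Z'} hZ hZ' := by
    have h1 : (fun p ↦ g.inner p (Y p) ((Z + Z') p)) =
        (fun p ↦ g.inner p (Y p) (Z p)) + fun p ↦ g.inner p (Y p) (Z' p) := by
      ext p; simp
    have h2 : (fun p ↦ g.inner p (X p) ((Z + Z') p)) =
        (fun p ↦ g.inner p (X p) (Z p)) + fun p ↦ g.inner p (X p) (Z' p) := by
      ext p; simp
    simp only [koszul]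
    rw [h1, h2, mvfderiv_add (g.mdifferentiableAt hY hZ) (g.mdifferentiableAt hY hZ'),
      mvfderiv_add (g.mdifferentiableAt hX hZ) (g.mdifferentiableAt hX hZ'),
      mlieBracket_add_right hZ hZ', mlieBracket_add_right hZ hZ']
    simp
    ring

lemma koszul_add {Y Y' X Z : Π x : M, TangentSpace I x} {x : M}
    (hY : MDiffAt (T% Y) x) (hY' : MDiffAt (T% Y') x) (hX : MDiffAt (T% X) x)
    (hZ : MDiffAt (T% Z) x) :
    koszul g (Y + Y') X Z x = koszul g Y X Z x + koszul g Y' X Z x := by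
  have h1 : (fun p ↦ g.inner p ((Y + Y') p) (Z p)) =
      (fun p ↦ g.inner p (Y p) (Z p)) + fun p ↦ g.inner p (Y' p) (Z p) := by
    ext p; simp
  have h2 : (fun p ↦ g.inner p (X p) ((Y + Y') p)) =
      (fun p ↦ g.inner p (X p) (Y p)) + fun p ↦ g.inner p (X p) (Y' p) := by
    ext p; simp
  simp only [koszul]
  rw [h1, h2, mvfderiv_add (g.mdifferentiableAt hY hZ) (g.mdifferentiableAt hY' hZ),
    mvfderiv_add (g.mdifferentiableAt hX hY) (g.mdifferentiableAt hX hY'),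
    mlieBracket_add_left hY hY', mlieBracket_add_right hY hY']
  simp
  ring

lemma koszul_smul {a : M → ℝ} {Y X Z : Π x : M, TangentSpace I x} {x : M}
    (ha : MDiffAt a x) (hY : MDiffAt (T% Y) x) (hX : MDiffAt (T% X) x)
    (hZ : MDiffAt (T% Z) x) :
    koszul g (a • Y) X Z x =
      a x * koszul g Y X Z x + 2 * (d% a x (X x) * g.inner x (Y x) (Z x)) := by
  have h1 : (fun p ↦ g.inner p ((a • Y) p) (Z p)) = a * fun p ↦ g.inner p (Y p) (Z p) := by
    ext p; simp
  have h2 : (fun p ↦ g.inner p (X p) ((a • Y) p)) = a * fun p ↦ g.inner p (X p) (Y p) := by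
    ext p; simp
  simp only [koszul]
  rw [h1, h2, mvfderiv_mul ha (g.mdifferentiableAt hY hZ),
    mvfderiv_mul ha (g.mdifferentiableAt hX hY), mlieBracket_smul_left ha hY,
    mlieBracket_smul_right ha hY]
  simp [g.symm x (Y x) (X x)]
  ring

/-- A connection on `TM` is the Levi-Civita connection of `g` if it is torsion-free and
`X g(Y, Z) = g(∇_X Y, Z) + g(Y, ∇_X Z)`. -/
structure IsLeviCivita (cov : CovariantDerivative I E (TangentSpace I : M → Type _)) : Prop where
  torsion_eq_zero : cov.torsion = 0
  metric : ∀ {X Y Z : Π x : M, TangentSpace I x} {x : M},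
    MDiffAt (T% X) x → MDiffAt (T% Y) x → MDiffAt (T% Z) x →
    d% (fun p ↦ g.inner p (Y p) (Z p)) x (X x) =
      g.inner x (cov Y x (X x)) (Z x) + g.inner x (Y x) (cov Z x (X x))

lemma Metric.exists_hom {x : M} (B : TangentSpace I x →L[ℝ] TangentSpace I x →L[ℝ] ℝ) :
    ∃ A : TangentSpace I x →L[ℝ] TangentSpace I x, ∀ u z, 2 * g.inner x (A u) z = B u z := by
  have : FiniteDimensional ℝ (TangentSpace I x) := inferInstanceAs (FiniteDimensional ℝ E)
  have : T2Space (TangentSpace I x) := inferInstanceAs (T2Space E)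
  let Φ : TangentSpace I x →ₗ[ℝ] Module.Dual ℝ (TangentSpace I x) :=
    { toFun := fun v ↦ (g.inner x v).toLinearMap
      map_add' := fun v w ↦ by ext z; simp
      map_smul' := fun c v ↦ by ext z; simp }
  let Ψ : TangentSpace I x →ₗ[ℝ] Module.Dual ℝ (TangentSpace I x) :=
    { toFun := fun v ↦ (B v).toLinearMap
      map_add' := fun v w ↦ by ext z; simp
      map_smul' := fun c v ↦ by ext z; simp }
  have hinj : Function.Injective Φ := fun a b h ↦
    g.nondegenerate fun z ↦ LinearMap.congr_fun h z
  let e := LinearEquiv.ofInjectiveOfFinrankEq Φ hinj Subspace.dual_finrank_eq.symm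
  have he : ∀ v, e v = Φ v := fun v ↦ LinearMap.congr_fun
    (LinearEquiv.coe_ofInjectiveOfFinrankEq Φ hinj Subspace.dual_finrank_eq.symm) v
  refine ⟨LinearMap.toContinuousLinearMap ((1 / 2 : ℝ) • (e.symm.toLinearMap ∘ₗ Ψ)), fun u z ↦ ?_⟩
  have h1 : Φ (e.symm (Ψ u)) = Ψ u := by rw [← he, e.apply_symm_apply]
  have h2 := LinearMap.congr_fun h1 z
  simp only [Φ, Ψ, LinearMap.coe_mk, AddHom.coe_mk, ContinuousLinearMap.coe_coe] at h2
  simp only [LinearMap.coe_toContinuousLinearMap', LinearMap.comp_apply,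
    LinearEquiv.coe_coe, map_smul, _root_.smul_apply, smul_eq_mul]
  rw [← h2]
  ring_nf
  rfl

theorem exists_isLeviCivita : ∃ cov, IsLeviCivita g cov := by
  classical
  have hK : ∀ (Y : Π x : M, TangentSpace I x) (x : M),
      ∃ A : TangentSpace I x →L[ℝ] TangentSpace I x, MDiffAt (T% Y) x →
        ∀ X Z : Π x : M, TangentSpace I x, MDiffAt (T% X) x → MDiffAt (T% Z) x →
          2 * g.inner x (A (X x)) (Z x) = koszul g Y X Z x := by
    intro Y x
    by_cases hY : MDiffAt (T% Y) x
    · obtain ⟨A, hA⟩ := g.exists_hom (TensorialAt.mkHom₂ (fun X Z ↦ koszul g Y X Z x) x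
        (fun Z hZ ↦ koszul_tensorial_left g hY hZ) (fun X hX ↦ koszul_tensorial_right g hY hX))
      refine ⟨A, fun _ X Z hX hZ ↦ ?_⟩
      rw [hA, TensorialAt.mkHom₂_apply _ _ hX hZ]
    · exact ⟨0, fun h ↦ absurd h hY⟩
  choose A hA using hK
  -- test an identity of tangent vectors against extensions
  have key : ∀ {x : M} {a b : TangentSpace I x},
      (∀ Z : Π x : M, TangentSpace I x, MDiffAt (T% Z) x →
        2 * g.inner x a (Z x) = 2 * g.inner x b (Z x)) → a = b := by
    intro x a b h
    refine g.nondegenerate fun z ↦ ?_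
    have := h (extend E z) (mdifferentiableAt_extend I E z)
    simpa using this
  have hcov : IsCovariantDerivativeOn E A := by
    refine ⟨fun {Y Y' x} hY hY' _ ↦ ?_, fun {Y a x} hY ha _ ↦ ?_⟩
    · ext u
      obtain ⟨X, hX, rfl⟩ : ∃ X : Π x : M, TangentSpace I x, MDiffAt (T% X) x ∧ X x = u :=
        ⟨extend E u, mdifferentiableAt_extend I E u, by simp⟩
      refine key fun Z hZ ↦ ?_
      rw [hA _ _ (mdifferentiableAt_add_section hY hY') X Z hX hZ, koszul_add g hY hY' hX hZ,
        ← hA _ _ hY X Z hX hZ, ← hA _ _ hY' X Z hX hZ]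
      simp
      ring
    · ext u
      obtain ⟨X, hX, rfl⟩ : ∃ X : Π x : M, TangentSpace I x, MDiffAt (T% X) x ∧ X x = u :=
        ⟨extend E u, mdifferentiableAt_extend I E u, by simp⟩
      refine key fun Z hZ ↦ ?_
      rw [hA _ _ (ha.smul_section hY) X Z hX hZ, koszul_smul g ha hY hX hZ,
        ← hA _ _ hY X Z hX hZ]
      simp
      ring
  refine ⟨⟨A, hcov⟩, ?_, ?_⟩
  · rw [CovariantDerivative.torsion_eq_zero_iff]
    intro X Y x hX hY
    refine key fun Z hZ ↦ ?_
    have h1 := hA Y x hY X Z hX hZ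
    have h2 := hA X x hX Y Z hY hZ
    have h3 : (fun p ↦ g.inner p (X p) (Y p)) = fun p ↦ g.inner p (Y p) (X p) := by
      ext p; exact g.symm p _ _
    simp only [koszul] at h1 h2
    rw [h3] at h1
    rw [mlieBracket_swap_apply (V := Y) (W := X)] at h2
    simp only [map_sub, map_neg, _root_.sub_apply, _root_.neg_apply] at h1 h2 ⊢
    linarith
  · intro X Y Z x hX hY hZ
    have h1 := hA Y x hY X Z hX hZ
    have h2 := hA Z x hZ X Y hX hY
    have h3 : (fun p ↦ g.inner p (Z p) (Y p)) = fun p ↦ g.inner p (Y p) (Z p) := by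
      ext p; exact g.symm p _ _
    simp only [koszul] at h1 h2
    rw [h3] at h2
    rw [mlieBracket_swap_apply (V := Z) (W := Y)] at h2
    rw [g.symm x (Y x)]
    simp only [map_neg, _root_.neg_apply] at h1 h2 ⊢
    linarith

variable {g} in
lemma IsLeviCivita.two_mul_inner {cov : CovariantDerivative I E (TangentSpace I : M → Type _)}
    (h : IsLeviCivita g cov) {X Y Z : Π x : M, TangentSpace I x} {x : M}
    (hX : MDiffAt (T% X) x) (hY : MDiffAt (T% Y) x) (hZ : MDiffAt (T% Z) x) :
    2 * g.inner x (cov Y x (X x)) (Z x) = koszul g Y X Z x := by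
  have ht : ∀ {X Y : Π x : M, TangentSpace I x}, MDiffAt (T% X) x → MDiffAt (T% Y) x →
      cov Y x (X x) - cov X x (Y x) = mlieBracket I X Y x :=
    fun hX hY ↦ cov.torsion_eq_zero_iff.mp h.torsion_eq_zero hX hY
  rw [koszul, ← ht hX hY, ← ht hX hZ, ← ht hY hZ, h.metric hX hY hZ,
    h.metric hY hX hZ, h.metric hZ hX hY]
  simp only [map_sub, _root_.sub_apply, g.symm x (X x)]
  rw [g.symm x (Y x) (cov Z x (X x))]
  ring

/-- The Levi-Civita connection is unique (on vector fields differentiable at the point). -/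
theorem IsLeviCivita.unique {cov cov' : CovariantDerivative I E (TangentSpace I : M → Type _)}
    (h : IsLeviCivita g cov) (h' : IsLeviCivita g cov') {Y : Π x : M, TangentSpace I x} {x : M}
    (hY : MDiffAt (T% Y) x) : cov Y x = cov' Y x := by
  ext u
  refine g.nondegenerate fun z ↦ ?_
  have h1 := h.two_mul_inner (mdifferentiableAt_extend I E u) hY (mdifferentiableAt_extend I E z)
  have h2 := h'.two_mul_inner (mdifferentiableAt_extend I E u) hY (mdifferentiableAt_extend I E z)
  rw [← h2] at h1
  simpa using h1

/-- The Levi-Civita connection of the metric `g`; `leviCivita g v m a` is `∇_a v` at `m`. -/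
def leviCivita : CovariantDerivative I E (TangentSpace I : M → Type _) :=
  (exists_isLeviCivita g).choose

theorem isLeviCivita_leviCivita : IsLeviCivita g (leviCivita g) :=
  (exists_isLeviCivita g).choose_spec

end Connection

/-! ### The pullback metric -/

section Pullback

variable {E : Type*} [NormedAddCommGroup E] [NormedSpace ℝ E] [FiniteDimensional ℝ E]
  {H : Type*} [TopologicalSpace H] {I : ModelWithCorners ℝ E H}
  {M : Type*} [TopologicalSpace M] [ChartedSpace H M] [IsManifold I ∞ M]
  {F : Type*} [NormedAddCommGroup F] [InnerProductSpace ℝ F]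

variable (F) in
/-- The inner product of `F` as an `ℝ`-bilinear map. -/
def innerBilin : F →L[ℝ] F →L[ℝ] ℝ := innerSL ℝ

/-- The pullback metric `g_f(u, v) = ⟨df(u), df(v)⟩` of an immersion `f : M → F`. -/
def pullbackMetric (f : M → F) (hf : ContMDiff I 𝓘(ℝ, F) ∞ f)
    (himm : ∀ m, Function.Injective (d% f m)) : Metric I M where
  inner m := (ContinuousLinearMap.precomp ℝ (d% f m)).comp
    ((innerBilin F).comp (d% f m))
  symm m u v := real_inner_comm _ _
  pos m u hu := by
    have : d% f m u ≠ 0 := fun h ↦ hu (himm m (by rw [h, map_zero]))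
    exact real_inner_self_pos.mpr this
  isVonNBounded m := by
    let L : E →ₗ[ℝ] F := (d% f m).toLinearMap
    have hL : Function.Injective L := himm m
    obtain ⟨K, -, hK⟩ := L.exists_antilipschitzWith (LinearMap.ker_eq_bot.mpr hL)
    change Bornology.IsVonNBounded ℝ {v : E | inner ℝ (L v) (L v) < 1}
    refine (NormedSpace.isVonNBounded_closedBall ℝ E K).subset fun v hv ↦ ?_
    have h1 : ‖v‖ ≤ K * ‖L v‖ := by simpa using hK.le_mul_dist v 0
    have h2 : ‖L v‖ < 1 := by
      have : ‖L v‖ ^ 2 < 1 := by rw [← real_inner_self_eq_norm_sq]; exact hv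
      nlinarith [norm_nonneg (L v)]
    rw [mem_closedBall_zero_iff]
    nlinarith [K.coe_nonneg, norm_nonneg (L v)]
  contMDiff := by
    intro x₀
    have h := (hf x₀).mfderiv_const (m := ∞) (by simp)
    rw [contMDiffAt_section]
    set T : M → E →L[ℝ] F :=
      inTangentCoordinates I 𝓘(ℝ, F) id f (fun x ↦ mfderiv I 𝓘(ℝ, F) f x) x₀ with hT
    have hQ : ContDiff ℝ ∞ (fun T : E →L[ℝ] F ↦ ((innerBilin F).comp T).flip.comp T) :=
      ((ContinuousLinearMap.flipₗᵢ ℝ E F ℝ).contDiff.comp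
        (contDiff_const.clm_comp contDiff_id)).clm_comp contDiff_id
    have h2 : ContMDiffAt I 𝓘(ℝ, E →L[ℝ] E →L[ℝ] ℝ) ∞
        (fun x ↦ ((innerBilin F).comp (T x)).flip.comp (T x)) x₀ :=
      hQ.contMDiff.contMDiffAt.comp x₀ h
    refine h2.congr_of_eventuallyEq ?_
    filter_upwards [(chartAt H x₀).open_source.mem_nhds (mem_chart_source H x₀)] with x hx
    ext u v
    simp [hT, hom_trivializationAt_apply, ContinuousLinearMap.inCoordinates, inTangentCoordinates,
      hx, mvfderiv]
    exact real_inner_comm _ _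

lemma pullbackMetric_inner (f : M → F) (hf : ContMDiff I 𝓘(ℝ, F) ∞ f)
    (himm : ∀ m, Function.Injective (d% f m)) (m : M) (u v : TangentSpace I m) :
    (pullbackMetric f hf himm).inner m u v = inner ℝ (d% f m u) (d% f m v) := rfl

end Pullback

/-! ### The Riemannian volume measure, Hessian, second fundamental form, and norms -/

section Penalty

variable {d D : ℕ} {H : Type*} [TopologicalSpace H]
  {I : ModelWithCorners ℝ (EuclideanSpace ℝ (Fin d)) H}
  {M : Type*} [TopologicalSpace M] [ChartedSpace H M] [IsManifold I ∞ M]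

/-- The Gram matrix `g(∂_i, ∂_k)` of the coordinate fields of the chart at `x`, at the point of
`M` with coordinates `y`. -/
def gramMatrix (g : Metric I M) (x : M) (y : EuclideanSpace ℝ (Fin d)) :
    Matrix (Fin d) (Fin d) ℝ :=
  Matrix.of fun i k ↦
    g.inner ((extChartAt I x).symm y)
      (mfderivWithin 𝓘(ℝ, EuclideanSpace ℝ (Fin d)) I (extChartAt I x).symm (Set.range I) y
        (EuclideanSpace.single i (1 : ℝ)))
      (mfderivWithin 𝓘(ℝ, EuclideanSpace ℝ (Fin d)) I (extChartAt I x).symm (Set.range I) y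
        (EuclideanSpace.single k (1 : ℝ)))

/-- The measure `√(det g_{ik}) dy` on the domain of the chart at `x`, extended by zero to `M`. -/
def chartVolume [MeasurableSpace M] (g : Metric I M) (x : M) : Measure M :=
  ((volume.restrict (extChartAt I x).target).withDensity
    (fun y ↦ ENNReal.ofReal (√(gramMatrix g x y).det))).map (extChartAt I x).symm

/-- The Riemannian volume measure: the measures `√(det g_{ik}) dy` of the various charts agree on
the overlaps of the charts, and `vol_g` is the measure obtained by gluing them, i.e. the smallest
measure which dominates all of them. -/
def riemannianVolume [MeasurableSpace M] (g : Metric I M) : Measure M :=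
  ⨆ x : M, chartVolume g x

/-- `e` is a `g`-orthonormal basis of `T_m M`. -/
def IsOrthonormalBasis (g : Metric I M) {m : M} (e : Fin d → TangentSpace I m) : Prop :=
  ∀ i k, g.inner m (e i) (e k) = if i = k then 1 else 0

lemma exists_isOrthonormalBasis (g : Metric I M) (m : M) :
    ∃ e : Fin d → TangentSpace I m, IsOrthonormalBasis g e := by
  have : FiniteDimensional ℝ (TangentSpace I m) :=
    inferInstanceAs (FiniteDimensional ℝ (EuclideanSpace ℝ (Fin d)))
  let : RiemannianBundle (fun x : M ↦ TangentSpace I x) := ⟨g.toRiemannianMetric⟩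
  have hd : Module.finrank ℝ (TangentSpace I m) = d :=
    finrank_euclideanSpace_fin (𝕜 := ℝ) (n := d)
  let b := (stdOrthonormalBasis ℝ (TangentSpace I m)).reindex (finCongr hd)
  exact ⟨b, fun i k ↦ orthonormal_iff_ite.mp b.orthonormal i k⟩

/-- The squared pointwise norm `|T|_g² = ∑_{i,k} T(e_i, e_k)²` of a bilinear form `T` on `T_m M`,
computed in a `g`-orthonormal basis (the value does not depend on the basis). -/
def pointwiseNormSq (g : Metric I M) (m : M)
    (T : TangentSpace I m → TangentSpace I m → ℝ) : ℝ :=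
  ∑ i, ∑ k, T ((exists_isOrthonormalBasis g m).choose i)
    ((exists_isOrthonormalBasis g m).choose k) ^ 2

/-- The squared pointwise norm `∑_j |J_j|_g²` of `J = (J_1, …, J_D)`. -/
def pointwiseNormSqVec (g : Metric I M) (m : M)
    (J : TangentSpace I m → TangentSpace I m → EuclideanSpace ℝ (Fin D)) : ℝ :=
  ∑ j, pointwiseNormSq g m (fun a b ↦ J a b j)

/-- The squared `L²` norm `∫_M |J(m)|_g² dvol_g(m)`. -/
def l2NormSq [MeasurableSpace M] (g : Metric I M)
    (J : (m : M) → TangentSpace I m → TangentSpace I m → EuclideanSpace ℝ (Fin D)) : ℝ :=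
  ∫ m, pointwiseNormSqVec g m (J m) ∂(riemannianVolume g)

/-- The value at the tangent vectors `a, b ∈ T_m M` of an operation `B` on pairs of vector fields:
extend `a` and `b` to vector fields which are smooth near `m`, and evaluate at `m`. This is
meaningful for tensorial `B`, whose values do not depend on the extensions. -/
def atVectors (B : (Π m : M, TangentSpace I m) → (Π m : M, TangentSpace I m) →
      M → EuclideanSpace ℝ (Fin D))
    (m : M) (a b : TangentSpace I m) : EuclideanSpace ℝ (Fin D) :=
  B (extend (EuclideanSpace ℝ (Fin d)) a) (extend (EuclideanSpace ℝ (Fin d)) b) m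

/-- The Hessian `∇²h(u, v) = u(v h) - (∇_u v) h` of a function `h : M → ℝ`. -/
def hessianScalar (g : Metric I M) (h : M → ℝ) (u v : Π m : M, TangentSpace I m) (m : M) : ℝ :=
  mvfderiv I (fun p ↦ mvfderiv I h p (v p)) m (u m) - mvfderiv I h m (leviCivita g v m (u m))

/-- The Hessian `∇²f = (∇²f_1, …, ∇²f_D)` of a map `f : M → ℝ^D`. -/
def hessian (g : Metric I M) (f : M → EuclideanSpace ℝ (Fin D))
    (u v : Π m : M, TangentSpace I m) (m : M) : EuclideanSpace ℝ (Fin D) :=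
  WithLp.toLp 2 fun j ↦ hessianScalar g (fun p ↦ f p j) u v m

/-- The normal space at `f(m)` of the immersed submanifold `f(M)`: the orthogonal complement of
the tangent space `df(T_m M)`. -/
def normalSpace (I : ModelWithCorners ℝ (EuclideanSpace ℝ (Fin d)) H)
    {M : Type*} [TopologicalSpace M] [ChartedSpace H M]
    (f : M → EuclideanSpace ℝ (Fin D)) (m : M) : Submodule ℝ (EuclideanSpace ℝ (Fin D)) :=
  (LinearMap.range (mvfderiv I f m).toLinearMap)ᗮ

/-- The second fundamental form of `f(M) ⊆ ℝ^D`: the normal component of the Euclidean covariant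
derivative of the tangent field `df(v)` in the direction `df(u)`. A field `W` along `f` is
differentiated in the direction `df(u)` by differentiating `m ↦ W(m) ∈ ℝ^D` in the direction `u`;
see `secondFundamentalForm_eq_of_extension` for the expression through an extension to `ℝ^D`. -/
def secondFundamentalForm (f : M → EuclideanSpace ℝ (Fin D))
    (u v : Π m : M, TangentSpace I m) (m : M) : EuclideanSpace ℝ (Fin D) :=
  (normalSpace I f m).starProjection (mvfderiv I (fun p ↦ mvfderiv I f p (v p)) m (u m))

lemma secondFundamentalForm_eq_of_extension {f : M → EuclideanSpace ℝ (Fin D)} {m : M}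
    (hf : MDifferentiableAt I 𝓘(ℝ, EuclideanSpace ℝ (Fin D)) f m)
    (u v : Π m : M, TangentSpace I m) {W : EuclideanSpace ℝ (Fin D) → EuclideanSpace ℝ (Fin D)}
    (hW : DifferentiableAt ℝ W (f m)) (h : ∀ᶠ p in 𝓝 m, W (f p) = mvfderiv I f p (v p)) :
    secondFundamentalForm f u v m =
      (normalSpace I f m).starProjection (fderiv ℝ W (f m) (mvfderiv I f m (u m))) := by
  have h1 : (fun p ↦ mvfderiv I f p (v p)) =ᶠ[𝓝 m] W ∘ f := h.mono fun p hp ↦ hp.symm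
  have h2 : mvfderiv I (fun p ↦ mvfderiv I f p (v p)) m (u m) =
      fderiv ℝ W (f m) (mvfderiv I f m (u m)) := by
    have h3 := h1.mfderiv_eq (I := I) (I' := 𝓘(ℝ, EuclideanSpace ℝ (Fin D)))
    have h4 := mfderiv_comp m hW.mdifferentiableAt hf
    rw [mfderiv_eq_fderiv] at h4
    exact DFunLike.congr_fun (h3.trans h4) (u m)
  rw [secondFundamentalForm, h2]

/-- `df(∇'_u v - ∇_u v)`, where `∇` and `∇'` are the Levi-Civita connections of `g` and `g'`. -/
def connectionMismatch (g g' : Metric I M) (f : M → EuclideanSpace ℝ (Fin D))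
    (u v : Π m : M, TangentSpace I m) (m : M) : EuclideanSpace ℝ (Fin D) :=
  mvfderiv I f m (leviCivita g' v m (u m) - leviCivita g v m (u m))

end Penalty

end EmbeddingPenalty

end

open EmbeddingPenalty

/-! The second derivative of `f` is symmetric, so `df([u,v]) = D_u(df v) - D_v(df u)`. Inserted with
the product rule into the Koszul formula of the pullback metric, this leaves `⟨df(∇^f_u v), df z⟩ =
⟨D_u(df v), df z⟩`, the Gauss formula (`inner_mvfderiv_mvfderiv`). Since `∇²f(u,v) = D_u(df v) -
df(∇_u v)` for any metric (`hessian_eq`), the Hessian taken with `g_f` is normal to `f(M)`, hence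
equals `II`. The mismatch term is then the difference of the Hessians for `g` and for `g_f`; it is
tangent, so Pythagoras gives the pointwise identities, and all three terms are tensorial because
Hessians are.

For the integrals, a squared norm in an orthonormal basis equals `tr(T G⁻¹ Tᵀ G⁻¹)` in any basis
with Gram matrix `G` (`sum_sq_eq_trace`). In coordinate frames this shows that the norms of both
Hessians are continuous, however the orthonormal bases vary with the point. On compact `M` the
volume is finite (`isFiniteMeasure_riemannianVolume`), so these norms are integrable, and the
mismatch integrand is integrable as their difference. -/

namespace EmbeddingPenalty

/-! ### Differentials along vector fields and the Lie bracket -/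

section Derivative

lemma two_le_infty : (2 : ℕ∞ω) ≤ ∞ :=
  WithTop.coe_le_coe.mpr (le_top : (2 : ℕ∞) ≤ ⊤)

variable {E : Type*} [NormedAddCommGroup E] [NormedSpace ℝ E]
  {H : Type*} [TopologicalSpace H] {I : ModelWithCorners ℝ E H}
  {M : Type*} [TopologicalSpace M] [ChartedSpace H M] [IsManifold I ∞ M]
  {F : Type*} [NormedAddCommGroup F] [NormedSpace ℝ F]

/-- The differential of a smooth map to a vector space is a smooth section of `Hom(TM, F)`. -/
lemma contMDiffAt_mvfderiv {f : M → F} {x₀ : M} (hf : CMDiffAt ∞ f x₀) :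
    ContMDiffAt I (I.prod 𝓘(ℝ, E →L[ℝ] F)) ∞
      (fun b ↦ TotalSpace.mk' (E →L[ℝ] F)
        (E := fun x : M ↦ TangentSpace I x →L[ℝ] Bundle.Trivial M F x) b (mvfderiv I f b)) x₀ := by
  rw [contMDiffAt_hom_bundle]
  refine ⟨contMDiffAt_id, ?_⟩
  have h := hf.mfderiv_const (m := ∞) (by simp)
  refine h.congr_of_eventuallyEq ?_
  filter_upwards [(chartAt H x₀).open_source.mem_nhds (mem_chart_source H x₀)] with x hx
  ext u
  simp [ContinuousLinearMap.inCoordinates, inTangentCoordinates, mvfderiv]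
  rfl

lemma mdifferentiableAt_mvfderiv_apply {f : M → F} (hf : ContMDiff I 𝓘(ℝ, F) ∞ f)
    {v : Π x : M, TangentSpace I x} {m : M} (hv : MDiffAt (T% v) m) :
    MDiffAt (fun p ↦ mvfderiv I f p (v p)) m := by
  have := MDifferentiableAt.clm_bundle_apply (F₁ := E) (F₂ := F)
    (E₂ := Bundle.Trivial M F) (b := id)
    ((contMDiffAt_mvfderiv (hf m)).mdifferentiableAt (by simp)) hv
  simp only [mdifferentiableAt_totalSpace] at this
  exact this.2

lemma contMDiffAt_mvfderiv_apply {f : M → F} {v : Π x : M, TangentSpace I x} {m : M}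
    (hf : CMDiffAt ∞ f m) (hv : CMDiffAt ∞ (T% v) m) :
    CMDiffAt ∞ (fun p ↦ mvfderiv I f p (v p)) m := by
  have := ContMDiffAt.clm_bundle_apply (F₁ := E) (F₂ := F)
    (E₂ := Bundle.Trivial M F) (b := id) (contMDiffAt_mvfderiv hf) hv
  simp only [contMDiffAt_totalSpace] at this
  exact this.2

open Set in
/-- The operator `w ↦ (p ↦ df(w))`, read in a chart. -/
lemma mvfderiv_apply_comp_extChartAt_symm {f : M → F} (hf : ContMDiff I 𝓘(ℝ, F) ∞ f)
    (w : Π x : M, TangentSpace I x) {m : M} {y : E} (hy : y ∈ (extChartAt I m).target) :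
    mvfderiv I f ((extChartAt I m).symm y) (w ((extChartAt I m).symm y)) =
      fderivWithin ℝ (f ∘ (extChartAt I m).symm) (range I) y
        (mpullbackWithin 𝓘(ℝ, E) I (extChartAt I m).symm w (range I) y) := by
  have h1 := mfderiv_comp_mfderivWithin y (hf.mdifferentiableAt (by simp))
    (mdifferentiableWithinAt_extChartAt_symm hy)
    (I.uniqueMDiffOn y (extChartAt_target_subset_range m hy))
  rw [mfderivWithin_eq_fderivWithin] at h1
  rw [h1, mpullbackWithin_apply]
  have h2 := (isInvertible_mfderivWithin_extChartAt_symm hy).self_apply_inverse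
    (w ((extChartAt I m).symm y))
  exact congrArg (mvfderiv I f ((extChartAt I m).symm y)) h2.symm

open Set in
/-- `df([u, v]) = D_u (df(v)) - D_v (df(u))`. -/
lemma mvfderiv_mlieBracket [CompleteSpace E] {f : M → F} (hf : ContMDiff I 𝓘(ℝ, F) ∞ f)
    {u v : Π x : M, TangentSpace I x} {m : M} (hu : MDiffAt (T% u) m) (hv : MDiffAt (T% v) m) :
    mvfderiv I f m (mlieBracket I u v m) =
      mvfderiv I (fun p ↦ mvfderiv I f p (v p)) m (u m) -
        mvfderiv I (fun p ↦ mvfderiv I f p (u p)) m (v m) := by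
  have hm : extChartAt I m m ∈ range I :=
    extChartAt_target_subset_range m (mem_extChartAt_target m)
  -- The derivative of the inverse chart at the base point is the identity, so pulling a field back
  -- does not change its value there.
  have hval : ∀ w : Π x : M, TangentSpace I x,
      mpullbackWithin 𝓘(ℝ, E) I (extChartAt I m).symm w (range I) (extChartAt I m m) = w m := by
    intro w
    rw [mpullbackWithin_apply, extChartAt_to_inv]
    exact mfderivWithin_extChartAt_symm_inverse_apply (w m)
  have key : ∀ w : Π x : M, TangentSpace I x, MDiffAt (T% w) m →
      mvfderiv I (fun p ↦ mvfderiv I f p (w p)) m =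
        fderivWithin ℝ (fun y ↦ fderivWithin ℝ (f ∘ (extChartAt I m).symm) (range I) y
          (mpullbackWithin 𝓘(ℝ, E) I (extChartAt I m).symm w (range I) y)) (range I)
          (extChartAt I m m) := by
    intro w hw
    rw [(mdifferentiableAt_mvfderiv_apply hf hw).mvfderiv]
    refine Filter.EventuallyEq.fderivWithin_eq_of_mem ?_ hm
    filter_upwards [extChartAt_target_mem_nhdsWithin (I := I) m] with y hy
    exact mvfderiv_apply_comp_extChartAt_symm hf w hy
  have hd : ∀ w : Π x : M, TangentSpace I x, MDiffAt (T% w) m →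
      DifferentiableWithinAt ℝ (mpullbackWithin 𝓘(ℝ, E) I (extChartAt I m).symm w (range I))
        (range I) (extChartAt I m m) := by
    intro w hw
    have := (mdifferentiableWithinAt_univ.mpr hw).differentiableWithinAt_mpullbackWithin_vectorField
    simpa using this
  have hc : ContDiffWithinAt ℝ ∞ (f ∘ (extChartAt I m).symm) (range I) (extChartAt I m m) :=
    (contMDiffAt_iff.mp (hf m)).2
  have hb : mlieBracket I u v m = lieBracketWithin ℝ
      (mpullbackWithin 𝓘(ℝ, E) I (extChartAt I m).symm u (range I))
      (mpullbackWithin 𝓘(ℝ, E) I (extChartAt I m).symm v (range I)) (range I)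
      (extChartAt I m m) := by
    -- The bracket on `M` is carried back from the chart by the inverse of the chart's derivative,
    -- which is the identity at the base point.
    have hid : ∀ T : E →L[ℝ] E, T = .id ℝ E → ∀ w : E, T.inverse w = w := by
      rintro _ rfl w
      simp
    rw [← mlieBracketWithin_univ, mlieBracketWithin_apply, preimage_univ, univ_inter]
    exact hid _ mfderiv_extChartAt_self _
  -- Symmetry of the second derivative also holds at boundary points, because they lie in the
  -- closure of the interior of `range I`.
  have h := fderivWithin_apply_lieBracket (V := mpullbackWithin 𝓘(ℝ, E) I (extChartAt I m).symm u
    (range I)) (W := mpullbackWithin 𝓘(ℝ, E) I (extChartAt I m).symm v (range I))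
    hc (by simpa using two_le_infty) I.uniqueDiffOn
    (I.range_subset_closure_interior hm) hm (hd v hv) (hd u hu)
  rw [hval, hval] at h
  rw [key v hv, key u hu, hb, ((hf m).mdifferentiableAt (by simp)).mvfderiv]
  exact h

end Derivative

/-! ### The Gauss formula -/

section Gauss

variable {E : Type*} [NormedAddCommGroup E] [NormedSpace ℝ E]
  {H : Type*} [TopologicalSpace H] {I : ModelWithCorners ℝ E H}
  {M : Type*} [TopologicalSpace M] [ChartedSpace H M]
  {F : Type*} [NormedAddCommGroup F]

lemma mvfderiv_inner_apply [InnerProductSpace ℝ F] {a b : M → F} {m : M}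
    (ha : MDiffAt a m) (hb : MDiffAt b m)
    (u : TangentSpace I m) :
    mvfderiv I (fun p ↦ inner ℝ (a p) (b p)) m u =
      inner ℝ (a m) (mvfderiv I b m u) + inner ℝ (mvfderiv I a m u) (b m) := by
  have hm : extChartAt I m m ∈ Set.range I :=
    extChartAt_target_subset_range m (mem_extChartAt_target m)
  have ha' : DifferentiableWithinAt ℝ (a ∘ (extChartAt I m).symm) (Set.range I)
    (extChartAt I m m) := (mdifferentiableAt_iff _ _).mp ha |>.2
  have hb' : DifferentiableWithinAt ℝ (b ∘ (extChartAt I m).symm) (Set.range I)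
    (extChartAt I m m) := (mdifferentiableAt_iff _ _).mp hb |>.2
  have hab : MDiffAt (fun p ↦ inner ℝ (a p) (b p)) m :=
    (mdifferentiableAt_iff _ _).mpr ⟨ha.continuousAt.inner hb.continuousAt,
      ha'.inner ℝ hb'⟩
  rw [hab.mvfderiv, ha.mvfderiv, hb.mvfderiv]
  have h := (ha'.hasFDerivWithinAt.inner ℝ hb'.hasFDerivWithinAt).fderivWithin
    (I.uniqueDiffOn _ hm)
  have h' := DFunLike.congr_fun h u
  simp only [Function.comp_apply, extChartAt_to_inv] at h'
  exact h'

lemma mvfderiv_clm_comp_apply [NormedSpace ℝ F] {F' : Type*} [NormedAddCommGroup F']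
    [NormedSpace ℝ F'] (A : F →L[ℝ] F') {a : M → F} {m : M} (ha : MDiffAt a m)
    (u : TangentSpace I m) :
    mvfderiv I (fun p ↦ A (a p)) m u = A (mvfderiv I a m u) := by
  have h := mfderiv_comp (I' := 𝓘(ℝ, F)) (I'' := 𝓘(ℝ, F')) m A.mdifferentiableAt ha
  rw [ContinuousLinearMap.mfderiv_eq] at h
  exact DFunLike.congr_fun h u

variable [IsManifold I ∞ M] [FiniteDimensional ℝ E] [InnerProductSpace ℝ F]

/-- The Gauss formula: the tangential component of `D_u (df(v))` is `df(∇^f_u v)`. -/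
lemma inner_mvfderiv_mvfderiv {f : M → F} (hf : ContMDiff I 𝓘(ℝ, F) ∞ f)
    (himm : ∀ m, Function.Injective (mvfderiv I f m))
    {u v z : Π x : M, TangentSpace I x} {m : M}
    (hu : MDiffAt (T% u) m) (hv : MDiffAt (T% v) m) (hz : MDiffAt (T% z) m) :
    inner ℝ (mvfderiv I f m (z m)) (mvfderiv I (fun p ↦ mvfderiv I f p (v p)) m (u m)) =
      inner ℝ (mvfderiv I f m (z m))
        (mvfderiv I f m (leviCivita (pullbackMetric f hf himm) v m (u m))) := by
  have h := (isLeviCivita_leviCivita (pullbackMetric f hf himm)).two_mul_inner hu hv hz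
  have du := mdifferentiableAt_mvfderiv_apply hf hu
  have dv := mdifferentiableAt_mvfderiv_apply hf hv
  have dz := mdifferentiableAt_mvfderiv_apply hf hz
  -- After expansion the Koszul expression is a sum of terms `⟨D_a(df b), df c⟩`; all cancel in
  -- pairs except two copies of `⟨D_u(df v), df z⟩`.
  simp only [koszul, pullbackMetric_inner, mvfderiv_mlieBracket hf hu hv,
    mvfderiv_mlieBracket hf hu hz, mvfderiv_mlieBracket hf hv hz, mvfderiv_inner_apply dv dz,
    mvfderiv_inner_apply du dz, mvfderiv_inner_apply du dv, inner_sub_left] at h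
  simp only [real_inner_comm] at h ⊢
  linarith

end Gauss

/-! ### The Hessian, the second fundamental form and tensoriality -/

section Hessian

variable {d D : ℕ} {H : Type*} [TopologicalSpace H]
  {I : ModelWithCorners ℝ (EuclideanSpace ℝ (Fin d)) H}
  {M : Type*} [TopologicalSpace M] [ChartedSpace H M] [IsManifold I ∞ M]
  {f : M → EuclideanSpace ℝ (Fin D)} {u v : Π x : M, TangentSpace I x} {m : M}

lemma hessian_eq (g : Metric I M) (hf : ContMDiff I 𝓘(ℝ, EuclideanSpace ℝ (Fin D)) ∞ f)
    (hv : MDiffAt (T% v) m) :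
    hessian g f u v m = mvfderiv I (fun p ↦ mvfderiv I f p (v p)) m (u m) -
      mvfderiv I f m (leviCivita g v m (u m)) := by
  have h1 : ∀ (j : Fin D) (p : M) (a : TangentSpace I p),
      mvfderiv I (fun q ↦ f q j) p a = mvfderiv I f p a j := fun j p a ↦
    mvfderiv_clm_comp_apply (EuclideanSpace.proj j : _ →L[ℝ] ℝ) (hf.mdifferentiableAt (by simp)) a
  ext j
  have h2 := mvfderiv_clm_comp_apply (EuclideanSpace.proj j : _ →L[ℝ] ℝ)
    (mdifferentiableAt_mvfderiv_apply hf hv) (u m)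
  simp only [PiLp.proj_apply] at h2
  simp [hessian, hessianScalar, h1, h2]

/-- This is the Gauss formula tested against `df(a)`, with `a` extended to a vector field. -/
lemma hessian_pullbackMetric_mem_normalSpace (hf : ContMDiff I 𝓘(ℝ, EuclideanSpace ℝ (Fin D)) ∞ f)
    (himm : ∀ m, Function.Injective (mvfderiv I f m))
    (hu : MDiffAt (T% u) m) (hv : MDiffAt (T% v) m) :
    hessian (pullbackMetric f hf himm) f u v m ∈ normalSpace I f m := by
  rw [hessian_eq _ hf hv, normalSpace, Submodule.mem_orthogonal]
  rintro - ⟨a, rfl⟩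
  have := inner_mvfderiv_mvfderiv hf himm hu hv
    (mdifferentiableAt_extend I (EuclideanSpace ℝ (Fin d)) a)
  simp only [extend_apply_self] at this
  rw [inner_sub_right]
  exact sub_eq_zero.mpr this

lemma inner_mvfderiv_eq_zero_of_mem_normalSpace {M : Type*} [TopologicalSpace M]
    [ChartedSpace H M] {f : M → EuclideanSpace ℝ (Fin D)} {m : M} {w : EuclideanSpace ℝ (Fin D)}
    (hw : w ∈ normalSpace I f m) (a : TangentSpace I m) : inner ℝ w (mvfderiv I f m a) = 0 :=
  (Submodule.mem_orthogonal' _ _).mp hw _ ⟨a, rfl⟩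

/-- The second fundamental form is the Hessian of `f` with respect to the pullback metric. -/
lemma secondFundamentalForm_eq (hf : ContMDiff I 𝓘(ℝ, EuclideanSpace ℝ (Fin D)) ∞ f)
    (himm : ∀ m, Function.Injective (mvfderiv I f m))
    (hu : MDiffAt (T% u) m) (hv : MDiffAt (T% v) m) :
    secondFundamentalForm f u v m = hessian (pullbackMetric f hf himm) f u v m := by
  -- The orthogonal projection is characterised by lying in the normal space with a remainder
  -- orthogonal to it; here the remainder is `df(∇^f_u v)`, which is tangent.
  refine Submodule.eq_starProjection_of_mem_of_inner_eq_zero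
    (hessian_pullbackMetric_mem_normalSpace hf himm hu hv) fun w hw ↦ ?_
  rw [hessian_eq _ hf hv, sub_sub_cancel, real_inner_comm]
  exact inner_mvfderiv_eq_zero_of_mem_normalSpace hw _

/-- The term `D_u(df v)` does not involve the metric and cancels. Tensoriality and integrability of
the mismatch thus reduce to those of Hessians. -/
lemma connectionMismatch_eq (g g' : Metric I M)
    (hf : ContMDiff I 𝓘(ℝ, EuclideanSpace ℝ (Fin D)) ∞ f) (hv : MDiffAt (T% v) m) :
    connectionMismatch g g' f u v m = hessian g f u v m - hessian g' f u v m := by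
  rw [hessian_eq _ hf hv, hessian_eq _ hf hv, connectionMismatch, map_sub]
  abel

lemma tensorialAt_hessian_left (g : Metric I M)
    (hf : ContMDiff I 𝓘(ℝ, EuclideanSpace ℝ (Fin D)) ∞ f) (hv : MDiffAt (T% v) m) :
    TensorialAt I (EuclideanSpace ℝ (Fin d)) (fun u ↦ hessian g f u v m) m where
  smul _ _ := by
    simp only [hessian_eq _ hf hv]
    simp [smul_sub]
  add _ _ := by
    simp only [hessian_eq _ hf hv]
    simp
    abel

/-- The Leibniz rule produces `(u a) df(v)` both in `D_u(a df v)` and in `df(∇_u(a v))`, and the two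
contributions cancel. -/
lemma tensorialAt_hessian_right (g : Metric I M)
    (hf : ContMDiff I 𝓘(ℝ, EuclideanSpace ℝ (Fin D)) ∞ f) :
    TensorialAt I (EuclideanSpace ℝ (Fin d)) (fun v ↦ hessian g f u v m) m where
  smul {a v} ha hv := by
    have h1 : (fun p ↦ mvfderiv I f p ((a • v) p)) = a • fun p ↦ mvfderiv I f p (v p) := by
      ext p; simp
    rw [hessian_eq _ hf hv, hessian_eq _ hf (ha.smul_section hv), h1,
      mvfderiv_smul ha (mdifferentiableAt_mvfderiv_apply hf hv),
      (leviCivita g).isCovariantDerivativeOnUniv.leibniz hv ha]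
    simp [smul_sub]
  add {v v'} hv hv' := by
    have h1 : (fun p ↦ mvfderiv I f p ((v + v') p)) =
        (fun p ↦ mvfderiv I f p (v p)) + fun p ↦ mvfderiv I f p (v' p) := by
      ext p; simp
    rw [hessian_eq _ hf hv, hessian_eq _ hf hv',
      hessian_eq _ hf (mdifferentiableAt_add_section hv hv'), h1,
      mvfderiv_add (mdifferentiableAt_mvfderiv_apply hf hv)
        (mdifferentiableAt_mvfderiv_apply hf hv'),
      (leviCivita g).isCovariantDerivativeOnUniv.add hv hv']
    simp
    abel

/-- The Hessian at a point, as a bilinear map on tangent vectors. -/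
lemma exists_bilinear_atVectors_hessian (g : Metric I M)
    (hf : ContMDiff I 𝓘(ℝ, EuclideanSpace ℝ (Fin D)) ∞ f) (m : M) :
    ∃ T : TangentSpace I m →L[ℝ] TangentSpace I m →L[ℝ] EuclideanSpace ℝ (Fin D),
      ∀ a b, atVectors (hessian g f) m a b = T a b :=
  ⟨TensorialAt.mkHom₂ (fun u v ↦ hessian g f u v m) m
    (fun _ hv ↦ tensorialAt_hessian_left g hf hv) (fun _ _ ↦ tensorialAt_hessian_right g hf),
    fun _ _ ↦ rfl⟩

lemma atVectors_hessian (g : Metric I M)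
    (hf : ContMDiff I 𝓘(ℝ, EuclideanSpace ℝ (Fin D)) ∞ f)
    (hu : MDiffAt (T% u) m) (hv : MDiffAt (T% v) m) :
    atVectors (hessian g f) m (u m) (v m) = hessian g f u v m :=
  TensorialAt.mkHom₂_apply (Φ := fun u v ↦ hessian g f u v m)
    (fun _ hv ↦ tensorialAt_hessian_left g hf hv) (fun _ _ ↦ tensorialAt_hessian_right g hf) hu hv

lemma atVectors_secondFundamentalForm (hf : ContMDiff I 𝓘(ℝ, EuclideanSpace ℝ (Fin D)) ∞ f)
    (himm : ∀ m, Function.Injective (mvfderiv I f m)) (m : M) (a b : TangentSpace I m) :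
    atVectors (secondFundamentalForm f) m a b =
      atVectors (hessian (pullbackMetric f hf himm) f) m a b :=
  secondFundamentalForm_eq hf himm (mdifferentiableAt_extend ..) (mdifferentiableAt_extend ..)

lemma atVectors_connectionMismatch (g g' : Metric I M)
    (hf : ContMDiff I 𝓘(ℝ, EuclideanSpace ℝ (Fin D)) ∞ f) (m : M) (a b : TangentSpace I m) :
    atVectors (connectionMismatch g g' f) m a b =
      atVectors (hessian g f) m a b - atVectors (hessian g' f) m a b :=
  connectionMismatch_eq g g' hf (mdifferentiableAt_extend ..)

/-- Pythagoras: the Hessian is a normal vector plus a vector in the range of `df`. -/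
lemma norm_sq_hessian (g : Metric I M) (hf : ContMDiff I 𝓘(ℝ, EuclideanSpace ℝ (Fin D)) ∞ f)
    (himm : ∀ m, Function.Injective (mvfderiv I f m))
    (hu : MDiffAt (T% u) m) (hv : MDiffAt (T% v) m) :
    ‖hessian g f u v m‖ ^ 2 = ‖secondFundamentalForm f u v m‖ ^ 2 +
      ‖connectionMismatch g (pullbackMetric f hf himm) f u v m‖ ^ 2 := by
  have h1 : hessian g f u v m = secondFundamentalForm f u v m +
      connectionMismatch g (pullbackMetric f hf himm) f u v m := by
    rw [connectionMismatch_eq _ _ hf hv, secondFundamentalForm_eq hf himm hu hv]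
    abel
  have h2 := inner_mvfderiv_eq_zero_of_mem_normalSpace
    (hessian_pullbackMetric_mem_normalSpace hf himm hu hv)
    (leviCivita (pullbackMetric f hf himm) v m (u m) - leviCivita g v m (u m))
  rw [← secondFundamentalForm_eq hf himm hu hv] at h2
  rw [h1, sq, sq, sq]
  exact norm_add_sq_eq_norm_sq_add_norm_sq_of_inner_eq_zero _ _ h2

end Hessian

/-! ### Norms of bilinear forms in arbitrary bases -/

section LinearAlgebra
open Matrix

lemma inv_eq_transpose_mul_self {ι : Type*} [Fintype ι] [DecidableEq ι] {C G : Matrix ι ι ℝ}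
    (h : C * G * Cᵀ = 1) : G⁻¹ = Cᵀ * C := by
  rw [Matrix.mul_assoc] at h
  exact Matrix.inv_eq_right_inv (by rw [← Matrix.mul_assoc]; exact mul_eq_one_comm.mp h)

/-- With `S = C T Cᵀ` the sum is `tr(S Sᵀ)`; cyclicity of the trace collects the factors `Cᵀ C =
G⁻¹`. -/
lemma sum_sq_eq_trace_of_mul_mul_transpose {ι : Type*} [Fintype ι] [DecidableEq ι]
    {C G : Matrix ι ι ℝ} (h : C * G * Cᵀ = 1) (T : Matrix ι ι ℝ) :
    ∑ i, ∑ k, (C * T * Cᵀ) i k ^ 2 = (T * G⁻¹ * Tᵀ * G⁻¹).trace := by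
  have h1 : ∑ i, ∑ k, (C * T * Cᵀ) i k ^ 2 = ((C * T * Cᵀ) * (C * T * Cᵀ)ᵀ).trace := by
    simp only [Matrix.trace, Matrix.diag_apply, Matrix.mul_apply (M := C * T * Cᵀ),
      Matrix.transpose_apply, sq]
  rw [h1, inv_eq_transpose_mul_self h, transpose_mul, transpose_mul, transpose_transpose]
  simp only [Matrix.mul_assoc]
  rw [Matrix.trace_mul_comm]
  simp only [Matrix.mul_assoc]

variable {d : ℕ} {H : Type*} [TopologicalSpace H]
  {I : ModelWithCorners ℝ (EuclideanSpace ℝ (Fin d)) H}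
  {M : Type*} [TopologicalSpace M] [ChartedSpace H M] {m : M}

/-- The matrix of a bilinear form on `T_m M` with respect to a family of tangent vectors. -/
noncomputable def bilinMatrix (B : TangentSpace I m →L[ℝ] TangentSpace I m →L[ℝ] ℝ)
    (s : Fin d → TangentSpace I m) : Matrix (Fin d) (Fin d) ℝ :=
  Matrix.of fun a b ↦ B (s a) (s b)

lemma repr_mul_bilinMatrix_mul_transpose
    (B : TangentSpace I m →L[ℝ] TangentSpace I m →L[ℝ] ℝ)
    (s : Module.Basis (Fin d) ℝ (TangentSpace I m)) (e : Fin d → TangentSpace I m) :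
    (Matrix.of fun i a ↦ s.repr (e i) a) * bilinMatrix B s *
      (Matrix.of fun i a ↦ s.repr (e i) a)ᵀ = bilinMatrix B e := by
  ext i k
  have h : B (e i) (e k) =
      B (∑ a, s.repr (e i) a • s a) (∑ b, s.repr (e k) b • s b) := by
    rw [s.sum_repr, s.sum_repr]
  rw [bilinMatrix, bilinMatrix, Matrix.of_apply, h]
  simp only [Matrix.mul_apply, Matrix.of_apply, Matrix.transpose_apply, map_sum, map_smul,
    _root_.sum_apply, _root_.smul_apply, smul_eq_mul, Finset.sum_mul]
  refine Finset.sum_congr rfl fun a _ ↦ ?_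
  rw [Finset.mul_sum]
  exact Finset.sum_congr rfl fun b _ ↦ by ring

variable [IsManifold I ∞ M] (g : Metric I M)

variable {g} in
lemma bilinMatrix_inner_eq_one {e : Fin d → TangentSpace I m} (he : IsOrthonormalBasis g e) :
    bilinMatrix (g.inner m) e = 1 := by
  ext i k
  rw [bilinMatrix, Matrix.of_apply, he, Matrix.one_apply]

variable {g} in
lemma repr_mul_gram_mul_transpose (s : Module.Basis (Fin d) ℝ (TangentSpace I m))
    {e : Fin d → TangentSpace I m} (he : IsOrthonormalBasis g e) :
    (Matrix.of fun i a ↦ s.repr (e i) a) * bilinMatrix (g.inner m) s *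
      (Matrix.of fun i a ↦ s.repr (e i) a)ᵀ = 1 := by
  rw [repr_mul_bilinMatrix_mul_transpose, bilinMatrix_inner_eq_one he]

/-- In the relation `C G Cᵀ = 1` coming from an orthonormal basis, `det G` is a factor of `1`. -/
lemma isUnit_det_gram (s : Module.Basis (Fin d) ℝ (TangentSpace I m)) :
    IsUnit (bilinMatrix (g.inner m) s).det := by
  obtain ⟨e, he⟩ := exists_isOrthonormalBasis g m
  have h := congrArg Matrix.det (repr_mul_gram_mul_transpose s he)
  rw [Matrix.det_mul, Matrix.det_mul, Matrix.det_one] at h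
  refine isUnit_iff_ne_zero.mpr fun h0 ↦ ?_
  simp [h0] at h

/-- Coordinates of a vector in terms of its inner products with a basis. -/
lemma eq_sum_inv_gram (s : Module.Basis (Fin d) ℝ (TangentSpace I m)) (w : TangentSpace I m) :
    w = ∑ b, (∑ a, g.inner m w (s a) * (bilinMatrix (g.inner m) s)⁻¹ a b) • s b := by
  have h1 : (fun a ↦ g.inner m w (s a)) = (fun b ↦ s.repr w b) ᵥ* bilinMatrix (g.inner m) s := by
    ext a
    have h : g.inner m w (s a) = g.inner m (∑ b, s.repr w b • s b) (s a) := by rw [s.sum_repr]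
    rw [h]
    simp only [map_sum, map_smul, _root_.sum_apply, _root_.smul_apply, smul_eq_mul,
      Matrix.vecMul, dotProduct, bilinMatrix, Matrix.of_apply]
  have h2 : (fun a ↦ g.inner m w (s a)) ᵥ* (bilinMatrix (g.inner m) s)⁻¹ = fun b ↦ s.repr w b := by
    rw [h1, Matrix.vecMul_vecMul, Matrix.mul_nonsing_inv _ (isUnit_det_gram g s),
      Matrix.vecMul_one]
  conv_lhs => rw [← s.sum_repr w]
  exact Finset.sum_congr rfl fun b _ ↦ by rw [← congrFun h2 b]; rfl

variable {g} in
/-- The squared norm of a bilinear form computed in an orthonormal basis, in terms of an arbitrary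
basis. -/
lemma sum_sq_eq_trace (s : Module.Basis (Fin d) ℝ (TangentSpace I m))
    {e : Fin d → TangentSpace I m} (he : IsOrthonormalBasis g e)
    (T : TangentSpace I m →L[ℝ] TangentSpace I m →L[ℝ] ℝ) :
    ∑ i, ∑ k, T (e i) (e k) ^ 2 =
      (bilinMatrix T s * (bilinMatrix (g.inner m) s)⁻¹ * (bilinMatrix T s)ᵀ *
        (bilinMatrix (g.inner m) s)⁻¹).trace := by
  rw [← sum_sq_eq_trace_of_mul_mul_transpose (repr_mul_gram_mul_transpose s he),
    repr_mul_bilinMatrix_mul_transpose]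
  rfl

end LinearAlgebra

/-! ### Continuity of the pointwise norms -/

section Continuity

open scoped Matrix

lemma one_le_infty : (((1 : ℕ∞) : ℕ∞ω)) ≤ ∞ :=
  WithTop.coe_le_coe.mpr (le_top : (1 : ℕ∞) ≤ ⊤)

lemma continuousAt_matrix_inv {ι : Type*} [Fintype ι] [DecidableEq ι] {A : Matrix ι ι ℝ}
    (hA : IsUnit A.det) : ContinuousAt (fun B : Matrix ι ι ℝ ↦ B⁻¹) A := by
  simp only [Matrix.inv_def, Ring.inverse_eq_inv']
  exact (Continuous.matrix_det continuous_id).continuousAt.inv₀ hA.ne_zero |>.smul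
    (Continuous.matrix_adjugate continuous_id).continuousAt

variable {d D : ℕ} {H : Type*} [TopologicalSpace H]
  {I : ModelWithCorners ℝ (EuclideanSpace ℝ (Fin d)) H}
  {M : Type*} [TopologicalSpace M] [ChartedSpace H M] [IsManifold I ∞ M]

lemma Metric.contMDiffAt (g : Metric I M) {n : ℕ∞ω} (hn : n ≤ ∞) {X Y : Π x : M, TangentSpace I x}
    {x : M} (hX : CMDiffAt n (T% X) x) (hY : CMDiffAt n (T% Y) x) :
    CMDiffAt n (fun p ↦ g.inner p (X p) (Y p)) x := by
  have := ContMDiffAt.clm_bundle_apply₂ (F₁ := EuclideanSpace ℝ (Fin d))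
    (F₂ := EuclideanSpace ℝ (Fin d)) (F₃ := ℝ)
    (E₃ := Bundle.Trivial M ℝ) (b := id) (g.contMDiff.contMDiffAt.of_le hn) hX hY
  simp only [contMDiffAt_totalSpace] at this
  exact this.2

lemma continuousAt_koszul (g : Metric I M) {X Y Z : Π x : M, TangentSpace I x} {x : M}
    (hY : CMDiffAt ∞ (T% Y) x) (hX : CMDiffAt ∞ (T% X) x) (hZ : CMDiffAt ∞ (T% Z) x) :
    ContinuousAt (koszul g Y X Z) x := by
  have h1 : ∀ {X Y Z : Π x : M, TangentSpace I x}, CMDiffAt ∞ (T% X) x → CMDiffAt ∞ (T% Y) x →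
      CMDiffAt ∞ (T% Z) x → ContinuousAt (fun q ↦ d% (fun p ↦ g.inner p (X p) (Y p)) q (Z q)) x :=
    fun hX hY hZ ↦ (contMDiffAt_mvfderiv_apply (g.contMDiffAt le_rfl hX hY) hZ).continuousAt
  have h2 : ∀ {X Y Z : Π x : M, TangentSpace I x}, CMDiffAt ∞ (T% X) x → CMDiffAt ∞ (T% Y) x →
      CMDiffAt ∞ (T% Z) x → ContinuousAt (fun q ↦ g.inner q (mlieBracket I X Y q) (Z q)) x := by
    intro X Y Z hX hY hZ
    have : IsManifold I (((1 : ℕ∞) : ℕ∞ω) + 1) M := IsManifold.of_le (n := ∞)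
      (by simpa [one_add_one_eq_two] using two_le_infty)
    have : IsManifold I (minSmoothness ℝ 2) M := IsManifold.of_le (n := ∞)
      (by simpa using two_le_infty)
    -- The bracket costs one derivative; only continuity of the result is needed.
    have h := ContMDiffAt.mlieBracket_vectorField (m := 0) (n := 1) 
      (hX.of_le one_le_infty) (hY.of_le one_le_infty) (by simp)
    exact (g.contMDiffAt (n := 0) (by simp) h (hZ.of_le (by simp))).continuousAt
  unfold koszul
  exact (((((h1 hY hZ hX).add (h1 hX hZ hY)).sub (h1 hX hY hZ)).add (h2 hX hY hZ)).sub
    (h2 hX hZ hY)).sub (h2 hY hZ hX)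

variable (I) in
/-- The coordinate vector fields of the chart at `x₀`. -/
noncomputable def coordFrame (x₀ : M) : Fin d → Π x : M, TangentSpace I x :=
  (trivializationAt (EuclideanSpace ℝ (Fin d)) (TangentSpace I) x₀).localFrame
    (EuclideanSpace.basisFun (Fin d) ℝ).toBasis

lemma contMDiffAt_coordFrame {x₀ p : M} (hp : p ∈ (chartAt H x₀).source) (i : Fin d) :
    CMDiffAt ∞ (T% (coordFrame I x₀ i)) p :=
  contMDiffAt_localFrame_of_mem _ _ _ i (by simpa using hp)

lemma exists_basis_eq_coordFrame {x₀ p : M} (hp : p ∈ (chartAt H x₀).source) :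
    ∃ s : Module.Basis (Fin d) ℝ (TangentSpace I p), ∀ i, s i = coordFrame I x₀ i p := by
  have hp' : p ∈ (trivializationAt (EuclideanSpace ℝ (Fin d)) (TangentSpace I) x₀).baseSet := by
    simpa using hp
  exact ⟨_, fun i ↦ (Trivialization.localFrame_apply_of_mem_baseSet _ _ hp').symm⟩

lemma continuousAt_gram (g : Metric I M) {x₀ p : M} (hp : p ∈ (chartAt H x₀).source) :
    ContinuousAt (fun q ↦ bilinMatrix (g.inner q) (fun i ↦ coordFrame I x₀ i q)) p :=
  continuousAt_pi.mpr fun i ↦ continuousAt_pi.mpr fun k ↦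
    (g.contMDiffAt le_rfl (contMDiffAt_coordFrame hp i) (contMDiffAt_coordFrame hp k)).continuousAt

lemma continuousAt_inv_gram (g : Metric I M) {x₀ p : M} (hp : p ∈ (chartAt H x₀).source) :
    ContinuousAt (fun q ↦ (bilinMatrix (g.inner q) (fun i ↦ coordFrame I x₀ i q))⁻¹) p := by
  obtain ⟨s, hs⟩ := exists_basis_eq_coordFrame (I := I) hp
  refine ContinuousAt.comp (f := fun q ↦ bilinMatrix (g.inner q) (fun i ↦ coordFrame I x₀ i q))
    (continuousAt_matrix_inv ?_) (continuousAt_gram g hp)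
  rw [← funext hs]
  exact isUnit_det_gram g s

variable {f : M → EuclideanSpace ℝ (Fin D)}

/-- `leviCivita` is obtained by choice, with no regularity attached. Continuity comes from writing
`∇` near `x₀` in the coordinate frame: its coefficients are half the Koszul expressions times the
inverse Gram matrix. -/
lemma continuousAt_hessian_coordFrame (g : Metric I M)
    (hf : ContMDiff I 𝓘(ℝ, EuclideanSpace ℝ (Fin D)) ∞ f) (x₀ : M) (i k : Fin d) :
    ContinuousAt (hessian g f (coordFrame I x₀ i) (coordFrame I x₀ k)) x₀ := by
  have hx₀ := mem_chart_source H x₀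
  have h1 : ContinuousAt (fun p ↦
      mvfderiv I (fun p ↦ mvfderiv I f p (coordFrame I x₀ k p)) p (coordFrame I x₀ i p) -
      ∑ b, (∑ a, koszul g (coordFrame I x₀ k) (coordFrame I x₀ i) (coordFrame I x₀ a) p / 2 *
        (bilinMatrix (g.inner p) (fun i ↦ coordFrame I x₀ i p))⁻¹ a b) •
        mvfderiv I f p (coordFrame I x₀ b p)) x₀ := by
    refine (contMDiffAt_mvfderiv_apply (contMDiffAt_mvfderiv_apply hf.contMDiffAt
      (contMDiffAt_coordFrame hx₀ k)) (contMDiffAt_coordFrame hx₀ i)).continuousAt.sub ?_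
    refine tendsto_finsetSum _ fun b _ ↦ Filter.Tendsto.smul ?_
      (contMDiffAt_mvfderiv_apply hf.contMDiffAt (contMDiffAt_coordFrame hx₀ b)).continuousAt
    refine tendsto_finsetSum _ fun a _ ↦ Filter.Tendsto.mul ?_ ?_
    · exact (continuousAt_koszul g (contMDiffAt_coordFrame hx₀ k) (contMDiffAt_coordFrame hx₀ i)
        (contMDiffAt_coordFrame hx₀ a)).div_const 2
    · exact continuousAt_pi.mp (continuousAt_pi.mp (continuousAt_inv_gram g hx₀) a) b
  refine h1.congr ?_
  filter_upwards [(chartAt H x₀).open_source.mem_nhds hx₀] with p hp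
  have hs := fun i ↦ (contMDiffAt_coordFrame (I := I) hp i).mdifferentiableAt (by simp)
  obtain ⟨s, hs'⟩ := exists_basis_eq_coordFrame (I := I) hp
  rw [hessian_eq g hf (hs k)]
  conv_rhs => rw [eq_sum_inv_gram g s (leviCivita g _ p _)]
  simp only [map_sum, map_smul, hs', funext hs']
  congr! 6 with b _ a _
  rw [← (isLeviCivita_leviCivita g).two_mul_inner (hs i) (hs k) (hs a)]
  ring

lemma sum_sum_norm_sq_eq {ι κ : Type*} [Fintype ι] [Fintype κ]
    (w : ι → κ → EuclideanSpace ℝ (Fin D)) :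
    ∑ i, ∑ k, ‖w i k‖ ^ 2 = ∑ j, ∑ i, ∑ k, w i k j ^ 2 := by
  simp only [EuclideanSpace.real_norm_sq_eq]
  exact (Finset.sum_congr rfl fun i _ ↦ Finset.sum_comm).trans Finset.sum_comm

/-- The right-hand side does not involve `e`. This yields both independence of the orthonormal basis
and continuity in the point. -/
lemma sum_sum_norm_sq_eq_sum_trace (g : Metric I M) {m : M}
    {e : Fin d → TangentSpace I m} (he : IsOrthonormalBasis g e)
    (s : Module.Basis (Fin d) ℝ (TangentSpace I m))
    (T : TangentSpace I m →L[ℝ] TangentSpace I m →L[ℝ] EuclideanSpace ℝ (Fin D)) :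
    ∑ i, ∑ k, ‖T (e i) (e k)‖ ^ 2 =
      ∑ j, ((Matrix.of fun a b ↦ T (s a) (s b) j) * (bilinMatrix (g.inner m) s)⁻¹ *
        (Matrix.of fun a b ↦ T (s a) (s b) j)ᵀ * (bilinMatrix (g.inner m) s)⁻¹).trace := by
  rw [sum_sum_norm_sq_eq]
  exact Finset.sum_congr rfl fun j _ ↦ sum_sq_eq_trace s he
    ((ContinuousLinearMap.postcomp (TangentSpace I m)
      (EuclideanSpace.proj j : EuclideanSpace ℝ (Fin D) →L[ℝ] ℝ)).comp T)

/-- The pointwise norm computed in an arbitrary orthonormal basis. -/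
lemma pointwiseNormSqVec_eq_sum (g : Metric I M) {m : M} {e : Fin d → TangentSpace I m}
    (he : IsOrthonormalBasis g e)
    (T : TangentSpace I m →L[ℝ] TangentSpace I m →L[ℝ] EuclideanSpace ℝ (Fin D)) :
    pointwiseNormSqVec g m (fun a b ↦ T a b) = ∑ i, ∑ k, ‖T (e i) (e k)‖ ^ 2 := by
  -- Any basis of the tangent space can serve as the intermediary between the two orthonormal bases.
  obtain ⟨s, -⟩ := exists_basis_eq_coordFrame (I := I) (mem_chart_source H m)
  rw [sum_sum_norm_sq_eq_sum_trace g he s,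
    ← sum_sum_norm_sq_eq_sum_trace g (exists_isOrthonormalBasis g m).choose_spec s]
  exact (sum_sum_norm_sq_eq _).symm

/-- Two metrics are needed: norms are always taken with `g`, while `II` is the Hessian for `g' =
g_f`. -/
lemma continuous_pointwiseNormSqVec_hessian (g g' : Metric I M)
    (hf : ContMDiff I 𝓘(ℝ, EuclideanSpace ℝ (Fin D)) ∞ f) :
    Continuous (fun m ↦ pointwiseNormSqVec g m (atVectors (hessian g' f) m)) := by
  refine continuous_iff_continuousAt.mpr fun x₀ ↦ ?_
  have hx₀ := mem_chart_source H x₀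
  have h1 : ∀ j, ContinuousAt (fun p ↦
      (Matrix.of fun a b ↦ hessian g' f (coordFrame I x₀ a) (coordFrame I x₀ b) p j)) x₀ :=
    fun j ↦ continuousAt_pi.mpr fun a ↦ continuousAt_pi.mpr fun b ↦
      (EuclideanSpace.proj j : EuclideanSpace ℝ (Fin D) →L[ℝ] ℝ).continuous.continuousAt.comp
        (continuousAt_hessian_coordFrame g' hf x₀ a b)
  have hG := continuousAt_inv_gram g hx₀
  have h2 : ContinuousAt (fun p ↦
      ∑ j, ((Matrix.of fun a b ↦ hessian g' f (coordFrame I x₀ a) (coordFrame I x₀ b) p j) *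
        (bilinMatrix (g.inner p) (fun i ↦ coordFrame I x₀ i p))⁻¹ *
        (Matrix.of fun a b ↦ hessian g' f (coordFrame I x₀ a) (coordFrame I x₀ b) p j)ᵀ *
        (bilinMatrix (g.inner p) (fun i ↦ coordFrame I x₀ i p))⁻¹).trace) x₀ := by
    refine tendsto_finsetSum _ fun j _ ↦ ?_
    exact (Continuous.matrix_trace continuous_id).continuousAt.comp
      ((((h1 j).mul hG).mul ((Continuous.matrix_transpose continuous_id).continuousAt.comp
        (h1 j))).mul hG)
  refine h2.congr ?_
  filter_upwards [(chartAt H x₀).open_source.mem_nhds hx₀] with p hp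
  have hs := fun i ↦ (contMDiffAt_coordFrame (I := I) hp i).mdifferentiableAt (by simp)
  obtain ⟨s, hs'⟩ := exists_basis_eq_coordFrame (I := I) hp
  obtain ⟨T, hT⟩ := exists_bilinear_atVectors_hessian g' hf p
  obtain ⟨e, he⟩ := exists_isOrthonormalBasis g p
  have hT' : atVectors (hessian g' f) p = fun a b ↦ T a b := funext₂ hT
  rw [hT', pointwiseNormSqVec_eq_sum g he, sum_sum_norm_sq_eq_sum_trace g he s, funext hs']
  refine Finset.sum_congr rfl fun j _ ↦ ?_
  simp only [← hT, atVectors_hessian g' hf (hs _) (hs _)]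

end Continuity

/-! ### Finiteness of the Riemannian volume -/

section Volume

variable {d : ℕ} {H : Type*} [TopologicalSpace H]
  {I : ModelWithCorners ℝ (EuclideanSpace ℝ (Fin d)) H}
  {M : Type*} [TopologicalSpace M] [ChartedSpace H M]

lemma measurableSet_extChartAt_target (x : M) : MeasurableSet (extChartAt I x).target := by
  rw [extChartAt_target]
  exact (((chartAt H x).open_target.preimage I.continuous_symm).measurableSet).inter
    I.isClosed_range.measurableSet

lemma measurableSet_target_inter_preimage [MeasurableSpace M] [BorelSpace M] (x : M) {A : Set M}
    (hA : MeasurableSet A) :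
    MeasurableSet ((extChartAt I x).target ∩ (extChartAt I x).symm ⁻¹' A) := by
  have h := (continuousOn_iff_continuous_domRestrict.mp
    (continuousOn_extChartAt_symm (I := I) x)).measurable hA
  rw [← Subtype.image_preimage_coe]
  exact (measurableSet_extChartAt_target x).subtype_image h

variable [IsManifold I ∞ M]

lemma coordFrame_apply {x p : M} (hp : p ∈ (chartAt H x).source) (i : Fin d) :
    coordFrame I x i p =
      (trivializationAt (EuclideanSpace ℝ (Fin d)) (TangentSpace I) x).symmL ℝ p
        (EuclideanSpace.single i 1) := by
  have hp' : p ∈ (trivializationAt (EuclideanSpace ℝ (Fin d)) (TangentSpace I) x).baseSet := by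
    simpa using hp
  rw [coordFrame, Trivialization.localFrame_apply_of_mem_baseSet _ _ hp']
  rw [Trivialization.symmL_apply _ hp']
  simp [Trivialization.basisAt]

lemma gramMatrix_eq (g : Metric I M) {x p : M} (hp : p ∈ (chartAt H x).source) :
    gramMatrix g x (extChartAt I x p) =
      bilinMatrix (g.inner p) (fun i ↦ coordFrame I x i p) := by
  ext i k
  simp only [bilinMatrix, Matrix.of_apply, coordFrame_apply hp,
    TangentBundle.symmL_trivializationAt hp]
  -- Forgetting the dependence of the tangent space on the point allows rewriting the base point
  -- inside the metric.
  let G : M → EuclideanSpace ℝ (Fin d) → EuclideanSpace ℝ (Fin d) → ℝ := fun q a b ↦ g.inner q a b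
  exact congrArg (fun q ↦ G q _ _) ((extChartAt I x).left_inv (by simpa using hp))

/-- The derivative of a change of charts, in the coordinate frames. -/
lemma exists_basis_repr_coordFrame {x x' p : M} (hp : p ∈ (chartAt H x).source)
    (hp' : p ∈ (chartAt H x').source) :
    ∃ s : Module.Basis (Fin d) ℝ (TangentSpace I p), (∀ i, s i = coordFrame I x' i p) ∧
      ∀ i a, s.repr (coordFrame I x i p) a =
        tangentCoordChange I x x' p (EuclideanSpace.single i 1) a := by
  have hx : p ∈ (trivializationAt (EuclideanSpace ℝ (Fin d)) (TangentSpace I) x).baseSet := by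
    simpa using hp
  have hx' : p ∈ (trivializationAt (EuclideanSpace ℝ (Fin d)) (TangentSpace I) x').baseSet := by
    simpa using hp'
  refine ⟨(trivializationAt (EuclideanSpace ℝ (Fin d)) (TangentSpace I) x').basisAt
    (EuclideanSpace.basisFun (Fin d) ℝ).toBasis hx',
    fun i ↦ (Trivialization.localFrame_apply_of_mem_baseSet _ _ hx').symm, fun i a ↦ ?_⟩
  have h1 := Trivialization.coordChangeL_apply (R := ℝ)
    (trivializationAt (EuclideanSpace ℝ (Fin d)) (TangentSpace I) x)
    (trivializationAt (EuclideanSpace ℝ (Fin d)) (TangentSpace I) x') ⟨hx, hx'⟩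
    (EuclideanSpace.single i 1)
  have h2 := (tangentBundleCore I M).localTriv_coordChange_eq (R := ℝ) (i := achart H x)
    (j := achart H x') (b := p) ⟨hx, hx'⟩ (EuclideanSpace.single i 1)
  have h3 := congrArg (fun w : EuclideanSpace ℝ (Fin d) ↦ w a) (h2.symm.trans h1)
  rw [coordFrame_apply hp, Trivialization.symmL_apply _ hx]
  simp only [Trivialization.basisAt, Module.Basis.map_repr]
  exact h3.symm

/-- If `C` is the matrix of the change of frames, the Gram matrices satisfy `G = C G' Cᵀ`, so `det G
= (det C)² det G'`. -/
lemma sqrt_det_gramMatrix (g : Metric I M) {x x' p : M} (hp : p ∈ (chartAt H x).source)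
    (hp' : p ∈ (chartAt H x').source) :
    √(gramMatrix g x (extChartAt I x p)).det =
      |(tangentCoordChange I x x' p).det| * √(gramMatrix g x' (extChartAt I x' p)).det := by
  obtain ⟨s, hs, hs'⟩ := exists_basis_repr_coordFrame (I := I) hp hp'
  set L := tangentCoordChange I x x' p
  have h1 : (Matrix.of fun i a ↦ s.repr (coordFrame I x i p) a).det = L.det := by
    rw [ContinuousLinearMap.det, ← LinearMap.det_toMatrix
      (EuclideanSpace.basisFun (Fin d) ℝ).toBasis, ← Matrix.det_transpose]
    congr 1
    ext i a
    simp [hs', LinearMap.toMatrix_apply]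
  rw [gramMatrix_eq g hp, gramMatrix_eq g hp', ← repr_mul_bilinMatrix_mul_transpose _ s,
    ← funext hs, Matrix.det_mul, Matrix.det_mul, Matrix.det_transpose, h1, mul_right_comm,
    Real.sqrt_mul (mul_self_nonneg _), Real.sqrt_mul_self_eq_abs]

variable [MeasurableSpace M] [BorelSpace M]

lemma chartVolume_apply (g : Metric I M) (x : M) {A : Set M} (hA : MeasurableSet A) :
    chartVolume g x A = ∫⁻ y in (extChartAt I x).target ∩ (extChartAt I x).symm ⁻¹' A,
      ENNReal.ofReal √(gramMatrix g x y).det := by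
  have h : AEMeasurable (extChartAt I x).symm (volume.restrict (extChartAt I x).target) :=
    (continuousOn_extChartAt_symm x).aemeasurable (measurableSet_extChartAt_target x)
  rw [chartVolume, Measure.map_apply_of_aemeasurable
    (h.mono_ac (withDensity_absolutelyContinuous _ _)) hA, withDensity_apply',
    Measure.restrict_restrict' (measurableSet_extChartAt_target x), Set.inter_comm]

lemma chartVolume_inter_source (g : Metric I M) (x : M) {A : Set M} (hA : MeasurableSet A) :
    chartVolume g x (A ∩ (chartAt H x).source) = chartVolume g x A := by
  rw [chartVolume_apply g x hA,
    chartVolume_apply g x (hA.inter (chartAt H x).open_source.measurableSet)]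
  congr 2
  ext y
  simp only [Set.mem_inter_iff, Set.mem_preimage, and_congr_right_iff, and_iff_left_iff_imp]
  intro hy _
  simpa using (extChartAt I x).map_target hy

/-- The chart volumes agree on the overlaps of the charts. -/
lemma chartVolume_eq_of_subset (g : Metric I M) {x x' : M} {A : Set M} (hA : MeasurableSet A)
    (hx : A ⊆ (chartAt H x).source) (hx' : A ⊆ (chartAt H x').source) :
    chartVolume g x A = chartVolume g x' A := by
  have hs : ∀ {x}, A ⊆ (chartAt H x).source →
      (extChartAt I x).target ∩ (extChartAt I x).symm ⁻¹' A = extChartAt I x '' A := by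
    intro x hx
    rw [(extChartAt I x).image_eq_target_inter_inv_preimage (by simpa using hx)]
  have hm := measurableSet_target_inter_preimage (I := I) x hA
  have hinv : ∀ p ∈ A, (extChartAt I x).symm (extChartAt I x p) = p := fun p hp ↦
    (extChartAt I x).left_inv (by simpa using hx hp)
  rw [chartVolume_apply g x hA, chartVolume_apply g x' hA, hs hx, hs hx']
  rw [hs hx] at hm
  have himage : extChartAt I x' '' A =
      (extChartAt I x' ∘ (extChartAt I x).symm) '' (extChartAt I x '' A) := by
    rw [Set.image_image]
    exact Set.image_congr fun p hp ↦ by rw [Function.comp_apply, hinv p hp]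
  -- Change of variables along the transition map; its Jacobian is exactly the factor relating the
  -- two densities.
  rw [himage, lintegral_image_eq_lintegral_abs_det_fderiv_mul volume hm
    (f' := fun y ↦ tangentCoordChange I x x' ((extChartAt I x).symm y))]
  · refine setLIntegral_congr_fun hm ?_
    rintro - ⟨p, hp, rfl⟩
    simp only [Function.comp_apply]
    rw [hinv p hp, sqrt_det_gramMatrix g (hx hp) (hx' hp), ENNReal.ofReal_mul (abs_nonneg _)]
  · rintro - ⟨p, hp, rfl⟩
    rw [hinv p hp]
    refine (hasFDerivWithinAt_tangentCoordChange
      ⟨by simpa using hx hp, by simpa using hx' hp⟩).mono ?_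
    rintro - ⟨q, -, rfl⟩
    exact ⟨_, rfl⟩
  · rintro - ⟨p, hp, rfl⟩ - ⟨q, hq, rfl⟩ h
    simp only [Function.comp_apply] at h
    rw [hinv p hp, hinv q hq] at h
    rw [(extChartAt I x').injOn (by simpa using hx' hp) (by simpa using hx' hq) h]

lemma exists_mem_nhds_chartVolume_lt_top (g : Metric I M) (x : M) :
    ∃ U, IsOpen U ∧ x ∈ U ∧ U ⊆ (chartAt H x).source ∧ chartVolume g x U < ⊤ := by
  have hx := mem_chart_source H x
  have h1 : ContinuousAt (fun q ↦ (bilinMatrix (g.inner q) (fun i ↦ coordFrame I x i q)).det) x :=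
    (Continuous.matrix_det continuous_id).continuousAt.comp (continuousAt_gram g hx)
  -- Near `x` the determinant stays below `B` and the chart stays in a unit ball, which bounds the
  -- volume by `√B` times that of the ball.
  obtain ⟨B, hB⟩ := exists_gt
    (bilinMatrix (g.inner x) (fun i ↦ coordFrame I x i x)).det
  have h2 := (h1.eventually (gt_mem_nhds hB)).and
    (((continuousAt_extChartAt (I := I) x).eventually (Metric.ball_mem_nhds _ one_pos)).and
      ((chartAt H x).open_source.mem_nhds hx))
  obtain ⟨U, hU, hUo, hxU⟩ := mem_nhds_iff.mp h2
  refine ⟨U, hUo, hxU, fun q hq ↦ (hU hq).2.2, ?_⟩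
  rw [chartVolume_apply g x hUo.measurableSet]
  refine (setLIntegral_mono' (g := fun _ ↦ ENNReal.ofReal √B)
    (measurableSet_target_inter_preimage x hUo.measurableSet) ?_).trans_lt ?_
  · rintro y ⟨hy, hy'⟩
    have h3 := (hU hy').1
    rw [← gramMatrix_eq g (hU hy').2.2, (extChartAt I x).right_inv hy] at h3
    exact ENNReal.ofReal_le_ofReal (Real.sqrt_le_sqrt h3.le)
  · rw [setLIntegral_const]
    refine ENNReal.mul_lt_top ENNReal.ofReal_lt_top ((measure_mono ?_).trans_lt
      (measure_ball_lt_top (x := extChartAt I x x) (r := 1)))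
    rintro y ⟨hy, hy'⟩
    have h3 := (hU hy').2.1
    rwa [(extChartAt I x).right_inv hy] at h3

/-- A supremum over all charts is finite once one finite measure dominates every chart volume. A
finite subcover by the sets `U p` supplies it: on `U p` the volume of any other chart agrees with
that of `p` wherever both charts are defined. -/
lemma isFiniteMeasure_riemannianVolume [CompactSpace M] (g : Metric I M) :
    IsFiniteMeasure (riemannianVolume g) := by
  choose U hUo hU hUs hUt using exists_mem_nhds_chartVolume_lt_top g
  obtain ⟨t, ht⟩ := isCompact_univ.elim_nhds_subcover U
    (fun x _ ↦ (hUo x).mem_nhds (hU x))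
  have hle : riemannianVolume g ≤ ∑ p ∈ t, (chartVolume g p).restrict (U p) := by
    refine iSup_le fun x ↦ Measure.le_iff.mpr fun A hA ↦ ?_
    have hAx := hA.inter (chartAt H x).open_source.measurableSet
    rw [← chartVolume_inter_source g x hA, Measure.finsetSum_apply]
    calc chartVolume g x (A ∩ (chartAt H x).source)
        ≤ chartVolume g x (⋃ p ∈ t, A ∩ (chartAt H x).source ∩ U p) := by
          refine measure_mono fun q hq ↦ ?_
          obtain ⟨p, hp, hq'⟩ := Set.mem_iUnion₂.mp (ht.2 (Set.mem_univ q))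
          exact Set.mem_iUnion₂.mpr ⟨p, hp, hq, hq'⟩
      _ ≤ ∑ p ∈ t, chartVolume g x (A ∩ (chartAt H x).source ∩ U p) :=
          measure_biUnion_finset_le _ _
      _ ≤ ∑ p ∈ t, (chartVolume g p).restrict (U p) A := by
          refine Finset.sum_le_sum fun p _ ↦ ?_
          rw [Measure.restrict_apply hA, chartVolume_eq_of_subset g
            (hAx.inter (hUo p).measurableSet) (fun q hq ↦ hq.1.2) (fun q hq ↦ hUs p hq.2)]
          exact measure_mono fun q hq ↦ ⟨hq.1.1, hq.2⟩
  refine ⟨(hle Set.univ).trans_lt ?_⟩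
  rw [Measure.finsetSum_apply]
  exact ENNReal.sum_lt_top.mpr fun p _ ↦ by simpa using hUt p

end Volume

/-! ### Integrability and the main theorem -/

section Penalty

variable {d D : ℕ} {H : Type*} [TopologicalSpace H]
  {I : ModelWithCorners ℝ (EuclideanSpace ℝ (Fin d)) H}
  {M : Type*} [TopologicalSpace M] [ChartedSpace H M] [IsManifold I ∞ M]
  {f : M → EuclideanSpace ℝ (Fin D)}

lemma integrable_pointwiseNormSqVec_hessian [CompactSpace M] [MeasurableSpace M] [BorelSpace M]
    (g g' : Metric I M) (hf : ContMDiff I 𝓘(ℝ, EuclideanSpace ℝ (Fin D)) ∞ f) :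
    Integrable (fun m ↦ pointwiseNormSqVec g m (atVectors (hessian g' f) m))
      (riemannianVolume g) := by
  have := isFiniteMeasure_riemannianVolume g
  have hc := continuous_pointwiseNormSqVec_hessian g g' hf
  obtain ⟨C, hC⟩ := isCompact_univ.exists_bound_of_continuousOn hc.continuousOn
  exact Integrable.of_bound hc.aestronglyMeasurable C (ae_of_all _ fun m ↦ hC m (Set.mem_univ m))

lemma pointwiseNormSqVec_hessian (g g' : Metric I M)
    (hf : ContMDiff I 𝓘(ℝ, EuclideanSpace ℝ (Fin D)) ∞ f) {m : M}
    {e : Fin d → TangentSpace I m} (he : IsOrthonormalBasis g e) :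
    pointwiseNormSqVec g m (atVectors (hessian g' f) m) =
      ∑ i, ∑ k, ‖atVectors (hessian g' f) m (e i) (e k)‖ ^ 2 := by
  obtain ⟨T, hT⟩ := exists_bilinear_atVectors_hessian g' hf m
  rw [show atVectors (hessian g' f) m = fun a b ↦ T a b from funext₂ hT]
  exact pointwiseNormSqVec_eq_sum g he T

/-- The pointwise decomposition of the squared norm of the Hessian. -/
lemma pointwiseNormSqVec_hessian_eq_add (g : Metric I M)
    (hf : ContMDiff I 𝓘(ℝ, EuclideanSpace ℝ (Fin D)) ∞ f)
    (himm : ∀ m, Function.Injective (mvfderiv I f m)) {m : M}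
    {e : Fin d → TangentSpace I m} (he : IsOrthonormalBasis g e) :
    pointwiseNormSqVec g m (atVectors (hessian g f) m) =
      pointwiseNormSqVec g m (atVectors (hessian (pullbackMetric f hf himm) f) m) +
        ∑ i, ∑ k, ‖atVectors (connectionMismatch g (pullbackMetric f hf himm) f) m
          (e i) (e k)‖ ^ 2 := by
  rw [pointwiseNormSqVec_hessian g g hf he, pointwiseNormSqVec_hessian g _ hf he]
  simp only [← Finset.sum_add_distrib, ← atVectors_secondFundamentalForm hf himm]
  exact Finset.sum_congr rfl fun i _ ↦ Finset.sum_congr rfl fun k _ ↦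
    norm_sq_hessian g hf himm (mdifferentiableAt_extend ..) (mdifferentiableAt_extend ..)

end Penalty

end EmbeddingPenalty

theorem mainTheorem9 {d D : ℕ} {H : Type*} [TopologicalSpace H]
    (I : ModelWithCorners ℝ (EuclideanSpace ℝ (Fin d)) H)
    {M : Type*} [TopologicalSpace M] [ChartedSpace H M] [IsManifold I ∞ M] [CompactSpace M]
    [MeasurableSpace M] [BorelSpace M]
    (g : Metric I M) (f : M → EuclideanSpace ℝ (Fin D))
    (hf : ContMDiff I 𝓘(ℝ, EuclideanSpace ℝ (Fin D)) ∞ f)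
    (hemb : Topology.IsEmbedding f)
    (himm : ∀ m, Function.Injective (mvfderiv I f m)) :
    -- the decomposition of the Hessian, and its pointwise orthogonality
    (∀ u v : Π m : M, TangentSpace I m,
      ContMDiff I I.tangent ∞ (fun m ↦ (⟨m, u m⟩ : TangentBundle I M)) →
      ContMDiff I I.tangent ∞ (fun m ↦ (⟨m, v m⟩ : TangentBundle I M)) →
      ∀ m : M,
        hessian g f u v m = secondFundamentalForm f u v m
          + mvfderiv I f m (leviCivita (pullbackMetric f hf himm) v m (u m)
              - leviCivita g v m (u m)) ∧
        secondFundamentalForm f u v m ∈ normalSpace I f m ∧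
        inner ℝ (secondFundamentalForm f u v m)
          (mvfderiv I f m (leviCivita (pullbackMetric f hf himm) v m (u m)
              - leviCivita g v m (u m))) = 0 ∧
        ‖hessian g f u v m‖ ^ 2 = ‖secondFundamentalForm f u v m‖ ^ 2
          + ‖mvfderiv I f m (leviCivita (pullbackMetric f hf himm) v m (u m)
              - leviCivita g v m (u m))‖ ^ 2 ∧
        -- the three terms depend only on the values of `u` and `v` at `m`
        hessian g f u v m = atVectors (hessian g f) m (u m) (v m) ∧
        secondFundamentalForm f u v m = atVectors (secondFundamentalForm f) m (u m) (v m) ∧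
        connectionMismatch g (pullbackMetric f hf himm) f u v m =
          atVectors (connectionMismatch g (pullbackMetric f hf himm) f) m (u m) (v m)) ∧
    -- the `L²` decomposition of the penalty
    Integrable (fun m ↦ pointwiseNormSqVec g m (atVectors (hessian g f) m))
      (riemannianVolume g) ∧
    Integrable (fun m ↦ pointwiseNormSqVec g m (atVectors (secondFundamentalForm f) m))
      (riemannianVolume g) ∧
    (∀ e : (m : M) → Fin d → TangentSpace I m, (∀ m, IsOrthonormalBasis g (e m)) →
      Integrable (fun m ↦ ∑ i, ∑ k, ‖atVectors
        (connectionMismatch g (pullbackMetric f hf himm) f) m (e m i) (e m k)‖ ^ 2)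
        (riemannianVolume g) ∧
      l2NormSq g (atVectors (hessian g f)) = l2NormSq g (atVectors (secondFundamentalForm f))
        + ∫ m, ∑ i, ∑ k, ‖atVectors
            (connectionMismatch g (pullbackMetric f hf himm) f) m (e m i) (e m k)‖ ^ 2
          ∂(riemannianVolume g) ∧
      ((∀ i k, AEStronglyMeasurable (fun m ↦ ‖atVectors
          (connectionMismatch g (pullbackMetric f hf himm) f) m (e m i) (e m k)‖ ^ 2)
          (riemannianVolume g)) →
        l2NormSq g (atVectors (hessian g f)) = l2NormSq g (atVectors (secondFundamentalForm f))
          + ∑ i, ∑ k, ∫ m, ‖atVectors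
              (connectionMismatch g (pullbackMetric f hf himm) f) m (e m i) (e m k)‖ ^ 2
            ∂(riemannianVolume g))) := by
  have hII : ∀ m, atVectors (secondFundamentalForm f) m =
      atVectors (hessian (pullbackMetric f hf himm) f) m := fun m ↦
    funext₂ (atVectors_secondFundamentalForm hf himm m)
  have hint := integrable_pointwiseNormSqVec_hessian g g hf
  have hint' := integrable_pointwiseNormSqVec_hessian g (pullbackMetric f hf himm) hf
  refine ⟨fun u v hu hv m ↦ ?_, hint, by simpa only [hII] using hint', fun e he ↦ ?_⟩
  · have hu' : MDiffAt (T% u) m := hu.mdifferentiableAt (by simp)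
    have hv' : MDiffAt (T% v) m := hv.mdifferentiableAt (by simp)
    have hS := secondFundamentalForm_eq hf himm hu' hv'
    have hC := connectionMismatch_eq (u := u) g (pullbackMetric f hf himm) hf hv'
    have hN : secondFundamentalForm f u v m ∈ normalSpace I f m :=
      hS ▸ hessian_pullbackMetric_mem_normalSpace hf himm hu' hv'
    refine ⟨?_, hN, inner_mvfderiv_eq_zero_of_mem_normalSpace hN _,
      norm_sq_hessian g hf himm hu' hv', (atVectors_hessian g hf hu' hv').symm, ?_, ?_⟩
    · change _ = _ + connectionMismatch g (pullbackMetric f hf himm) f u v m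
      rw [hC, hS]
      abel
    · rw [atVectors_secondFundamentalForm hf himm, atVectors_hessian _ hf hu' hv', hS]
    · rw [atVectors_connectionMismatch _ _ hf, atVectors_hessian _ hf hu' hv',
        atVectors_hessian _ hf hu' hv', hC]
  · have hdec := fun m ↦ pointwiseNormSqVec_hessian_eq_add g hf himm (he m)
    -- The bases `e m` may depend on `m` in a non-measurable way; the full sum is nevertheless a
    -- difference of two integrable functions at every point.
    have hmis : Integrable (fun m ↦ ∑ i, ∑ k, ‖atVectors
        (connectionMismatch g (pullbackMetric f hf himm) f) m (e m i) (e m k)‖ ^ 2)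
        (riemannianVolume g) :=
      (hint.sub hint').congr (ae_of_all _ fun m ↦ by
        rw [Pi.sub_apply, hdec, add_sub_cancel_left])
    have hsum : l2NormSq g (atVectors (hessian g f)) =
        l2NormSq g (atVectors (secondFundamentalForm f)) + ∫ m, ∑ i, ∑ k, ‖atVectors
          (connectionMismatch g (pullbackMetric f hf himm) f) m (e m i) (e m k)‖ ^ 2
          ∂(riemannianVolume g) := by
      simp only [l2NormSq, hII]
      rw [← integral_add hint' hmis]
      exact integral_congr_ae (ae_of_all _ hdec)
    refine ⟨hmis, hsum, fun hmeas ↦ ?_⟩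
    have hik : ∀ i k, Integrable (fun m ↦ ‖atVectors
        (connectionMismatch g (pullbackMetric f hf himm) f) m (e m i) (e m k)‖ ^ 2)
        (riemannianVolume g) := by
      -- A single summand need not be measurable without `hmeas`; given that, the nonnegative full
      -- sum dominates it.
      refine fun i k ↦ hmis.mono' (hmeas i k) (ae_of_all _ fun m ↦ ?_)
      rw [Real.norm_of_nonneg (sq_nonneg _)]
      exact (Finset.single_le_sum (f := fun k ↦ ‖atVectors
          (connectionMismatch g (pullbackMetric f hf himm) f) m (e m i) (e m k)‖ ^ 2)
          (fun _ _ ↦ sq_nonneg _) (Finset.mem_univ k)).trans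
        (Finset.single_le_sum (f := fun i ↦ ∑ k, ‖atVectors
          (connectionMismatch g (pullbackMetric f hf himm) f) m (e m i) (e m k)‖ ^ 2)
          (fun _ _ ↦ Finset.sum_nonneg fun _ _ ↦ sq_nonneg _) (Finset.mem_univ i))
    rw [hsum, integral_finsetSum _ fun i _ ↦ integrable_finsetSum _ fun k _ ↦ hik i k]
    simp only [integral_finsetSum _ fun k _ ↦ hik _ k]
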